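/- Let $\mathcal{H}_A,\mathcal{H}_B$ be finite-dimensional complex Hilbert spaces with $\mathcal{H}_A\neq 0$, let $\mathcal{S}(\mathcal{H})$ denote the set of density operators on $\mathcal{H}$ (positive semidefinite operators of trace one), and let $\mathcal{N}:\mathcal{B}(\mathcal{H}_A)\to\mathcal{B}(\mathcal{H}_B)$ be a quantum channel, that is, a completely positive trace-preserving linear map. For positive semidefinite operators $A,B$ on the same finite-dimensional Hilbert space and $\alpha>1$, put $$\widetilde{Q}_\alpha(A\|B)=\begin{cases}\operatorname{Tr}\Big\{\big(B^{\frac{1-\alpha}{2\alpha}}AB^{\frac{1-\alpha}{2\alpha}}\big)^{\alpha}\Big\} & \text{if } \operatorname{supp}(A)\subseteq\operatorname{supp}(B),\\ \infty & \text{otherwise,}\end{cases}\qquad \widetilde{D}_\alpha(A\|B)=\frac{1}{\alpha-1}\log_2\widetilde{Q}_\alpha(A\|B)\in[-\infty,\infty],$$ where negative powers of $B$ are taken on the support of $B$. For a finite ensemble $\{p_X(x),\rho_x\}$ of states on $\mathcal{H}_B$, let $$\rho_{XB}=\sum_x p_X(x)\,|x\rangle\langle x|_X\otimes\rho_x,\qquad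 \rho_X=\operatorname{Tr}_B\{\rho_{XB}\},\qquad \widetilde{\chi}_\alpha(\{p_X(x),\rho_x\})=\min_{\sigma\in\mathcal{S}(\mathcal{H}_B)}\widetilde{D}_\alpha(\rho_{XB}\|\rho_X\otimes\sigma).$$ Define the $\alpha$-Holevo information and the $\alpha$-information radius of $\mathcal{N}$ by $$\widetilde{\chi}_\alpha(\mathcal{N})=\max_{\{p_X(x),\rho_x\}}\widetilde{\chi}_\alpha(\{p_X(x),\mathcal{N}(\rho_x)\}),\qquad \widetilde{K}_\alpha(\mathcal{N})=\min_{\sigma\in\mathcal{S}(\mathcal{H}_B)}\ \max_{\rho\in\mathcal{S}(\mathcal{H}_A)}\widetilde{D}_\alpha(\mathcal{N}(\rho)\|\sigma),$$ where the first maximum is over all finite ensembles of states on $\mathcal{H}_A$. Then for every $\alpha\in(1,2]$ all of these minima and maxima (the minimum over $\sigma$ for each ensemble $\{p_X(x),\mathcal{N}(\rho_x)\}$ of channel outputs, and the maximum over $\rho$ for each $\sigma$, included) are attained, and $$\widetilde{\chi}_\alpha(\mathcal{N})=\widetilde{K}_\alpha(\mathcal{N}).$$ -/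

import Mathlib

open scoped ENNReal Kronecker ComplexOrder MatrixOrder

noncomputable section

namespace SandwichedRenyi

/-- Density operators on the finite-dimensional Hilbert space `ℂ^n`: positive semidefinite
operators of trace one. -/
structure DensityOperator (n : Type*) [Fintype n] where
  toMatrix : Matrix n n ℂ
  posSemidef : toMatrix.PosSemidef
  trace_eq_one : toMatrix.trace = 1

/-- The map `id_R ⊗ N` on operators on `ℂ^R ⊗ ℂ^a`: the map `N` is applied to each of the blocks
`X_{r r'}` of `X = ∑ |r⟩⟨r'| ⊗ X_{r r'}`. -/
def idTensor (r : Type*) {a b : Type*} (N : Matrix a a ℂ →ₗ[ℂ] Matrix b b ℂ)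
    (X : Matrix (r × a) (r × a) ℂ) : Matrix (r × b) (r × b) ℂ :=
  Matrix.of fun i j => N (Matrix.of fun k l => X (i.1, k) (j.1, l)) i.2 j.2

/-- Complete positivity: `id_R ⊗ N` is a positive map for every finite-dimensional reference
system `R`. -/
def IsCompletelyPositive {a b : Type*} (N : Matrix a a ℂ →ₗ[ℂ] Matrix b b ℂ) : Prop :=
  ∀ (d : ℕ) (X : Matrix (Fin d × a) (Fin d × a) ℂ),
    X.PosSemidef → (idTensor (Fin d) N X).PosSemidef

/-- Quantum channels: completely positive trace-preserving linear maps. -/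
structure QuantumChannel (a b : Type*) [Fintype a] [Fintype b] where
  toLinearMap : Matrix a a ℂ →ₗ[ℂ] Matrix b b ℂ
  completelyPositive : IsCompletelyPositive toLinearMap
  tracePreserving : ∀ X : Matrix a a ℂ, (toLinearMap X).trace = X.trace

theorem IsCompletelyPositive.posSemidef {a b : Type*}
    {N : Matrix a a ℂ →ₗ[ℂ] Matrix b b ℂ} (hN : IsCompletelyPositive N)
    {X : Matrix a a ℂ} (hX : X.PosSemidef) : (N X).PosSemidef :=
  (hN 1 (X.submatrix Prod.snd Prod.snd) (hX.submatrix Prod.snd)).submatrix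
    (fun j : b => ((0 : Fin 1), j))

/-- The output state `N(ρ)` of a channel. -/
def QuantumChannel.apply {a b : Type*} [Fintype a] [Fintype b] (N : QuantumChannel a b)
    (ρ : DensityOperator a) : DensityOperator b where
  toMatrix := N.toLinearMap ρ.toMatrix
  posSemidef := N.completelyPositive.posSemidef ρ.posSemidef
  trace_eq_one := (N.tracePreserving _).trans ρ.trace_eq_one

/-- A (finite) ensemble `{p_X(x), ρ_x}` of quantum states. -/
structure Ensemble (n : Type*) [Fintype n] where
  size : ℕ
  prob : Fin size → ℝ
  prob_nonneg : ∀ x, 0 ≤ prob x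
  sum_prob : ∑ x, prob x = 1
  state : Fin size → DensityOperator n

/-- The ensemble `{p_X(x), N(ρ_x)}` of channel outputs. -/
def Ensemble.map {a b : Type*} [Fintype a] [Fintype b] (E : Ensemble a)
    (N : QuantumChannel a b) : Ensemble b where
  size := E.size
  prob := E.prob
  prob_nonneg := E.prob_nonneg
  sum_prob := E.sum_prob
  state x := N.apply (E.state x)

/-- The classical-quantum state `ρ_XQ = ∑ₓ p_X(x) |x⟩⟨x| ⊗ ρ_x` of an ensemble. -/
def Ensemble.cqState {n : Type*} [Fintype n] (E : Ensemble n) :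
    Matrix (Fin E.size × n) (Fin E.size × n) ℂ :=
  ∑ x, (E.prob x : ℂ) • (Matrix.single x x (1 : ℂ) ⊗ₖ (E.state x).toMatrix)

/-- The partial trace over the second tensor factor. -/
def partialTraceRight {m n : Type*} [Fintype n] (M : Matrix (m × n) (m × n) ℂ) :
    Matrix m m ℂ :=
  Matrix.of fun i j => ∑ k, M (i, k) (j, k)

/-- The support of a (Hermitian) operator: the orthogonal complement of its kernel. -/
def supp {n : Type*} [Fintype n] [DecidableEq n] (A : Matrix n n ℂ) :
    Submodule ℂ (EuclideanSpace ℂ n) :=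
  (LinearMap.ker (Matrix.toEuclideanLin A))ᗮ

open Classical in
/-- The sandwiched quasi-relative entropy
`Q_α(A‖B) = Tr ((B^((1-α)/(2α)) A B^((1-α)/(2α)))^α)` of positive semidefinite operators if
`supp A ⊆ supp B`, and `∞` otherwise. The powers are those of the continuous functional calculus;
nonzero powers vanish on the kernel, so that negative powers are taken on the support. -/
def sandwichedQ {n : Type*} [Fintype n] [DecidableEq n] (α : ℝ) (A B : Matrix n n ℂ) : ℝ≥0∞ :=
  if supp A ≤ supp B then
    ENNReal.ofReal
      (((B ^ ((1 - α) / (2 * α)) * A * B ^ ((1 - α) / (2 * α))) ^ α).trace).re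
  else ∞

/-- The base two logarithm with values in the extended reals: `log 0 = -∞`, `log ∞ = ∞`. -/
def log₂ (q : ℝ≥0∞) : EReal := ENNReal.log q / ((Real.log 2 : ℝ) : EReal)

/-- The sandwiched Rényi relative entropy `D_α(A‖B) = (1/(α-1)) log Q_α(A‖B)`. -/
def sandwichedD {n : Type*} [Fintype n] [DecidableEq n] (α : ℝ) (A B : Matrix n n ℂ) : EReal :=
  ((1 / (α - 1) : ℝ) : EReal) * log₂ (sandwichedQ α A B)

/-- The divergence `D_α(ρ_XQ ‖ ρ_X ⊗ σ)` for the classical-quantum state of an ensemble, where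
`ρ_X = Tr_Q ρ_XQ`. -/
def ensembleDivergence {n : Type*} [Fintype n] [DecidableEq n] (α : ℝ) (E : Ensemble n)
    (σ : DensityOperator n) : EReal :=
  sandwichedD α E.cqState (partialTraceRight E.cqState ⊗ₖ σ.toMatrix)

/-- The quantity `χ_α({p_X(x), ρ_x}) = min_σ D_α(ρ_XQ ‖ ρ_X ⊗ σ)` of an ensemble. -/
def ensembleHolevo {n : Type*} [Fintype n] [DecidableEq n] (α : ℝ) (E : Ensemble n) : EReal :=
  ⨅ σ : DensityOperator n, ensembleDivergence α E σ

/-- The `α`-Holevo information of a channel,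
`χ_α(N) = max_{p_X(x), ρ_x} χ_α({p_X(x), N(ρ_x)})`. -/
def alphaHolevo {a b : Type*} [Fintype a] [Fintype b] [DecidableEq b] (α : ℝ)
    (N : QuantumChannel a b) : EReal :=
  ⨆ E : Ensemble a, ensembleHolevo α (E.map N)

/-- The largest divergence `max_ρ D_α(N(ρ)‖σ)` of a channel output from `σ`. -/
def maxOutputDivergence {a b : Type*} [Fintype a] [Fintype b] [DecidableEq b] (α : ℝ)
    (N : QuantumChannel a b) (σ : DensityOperator b) : EReal :=
  ⨆ ρ : DensityOperator a, sandwichedD α (N.apply ρ).toMatrix σ.toMatrix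

/-- The `α`-information radius of a channel, `K_α(N) = min_σ max_ρ D_α(N(ρ)‖σ)`. -/
def alphaRadius {a b : Type*} [Fintype a] [Fintype b] [DecidableEq b] (α : ℝ)
    (N : QuantumChannel a b) : EReal :=
  ⨅ σ : DensityOperator b, maxOutputDivergence α N σ

end SandwichedRenyi

end

/-! Since D is an increasing function of Q, everything reduces to a minimax equality for
`sandwichedQ`. The operators ρ_XB and ρ_X ⊗ σ are block diagonal with blocks p(x)ρ_x and p(x)σ, and
Q is additive over blocks and homogeneous of degree one under joint scaling. Hence Q(ρ_XB‖ρ_X ⊗ σ)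
is the average ∑ p(x) Q(ρ_x‖σ) (`Ensemble.sandwichedQ_cqState`). An ensemble is thus a finitely
supported mixed strategy on input states, so no concavity in ρ is needed.

What is needed is convexity and lower semicontinuity in σ. For σ of full rank, Q(A‖σ) = Tr (A^(1/2)
σ^(-s) A^(1/2))^α with s = (α-1)/α in (0,1). Here σ ↦ σ^(-s) is operator antitone and operator
convex, and X ↦ Tr X^α is monotone and convex. Singular σ are reached through σ + ε1, because Q(A‖σ
+ ε1) increases to Q(A‖σ), possibly ∞, as ε decreases to 0.

The minimax theorem `exists_minimax` uses Helly's theorem to replace all inputs by finitely many and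
a separating hyperplane to find their weights. This is carried out on full-rank σ, where Q is finite
and continuous in ρ, and extended to singular σ along segments. -/

noncomputable section

namespace SandwichedRenyi

open Matrix Filter Topology

/-! ### Spectral calculus and traces of powers -/

section

variable {n : Type*} [Fintype n] [DecidableEq n]

/-- The matrix with eigenvalues `d` in the orthonormal basis given by the columns of `U`. -/
def conjDiagonal (U : unitaryGroup n ℂ) (d : n → ℝ) : Matrix n n ℂ :=
  (U : Matrix n n ℂ) * diagonal (fun i => (d i : ℂ)) * star (U : Matrix n n ℂ)

theorem unitary_mul_star (U : unitaryGroup n ℂ) :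
    (U : Matrix n n ℂ) * star (U : Matrix n n ℂ) = 1 := Unitary.coe_mul_star_self U

theorem star_mul_unitary (U : unitaryGroup n ℂ) :
    star (U : Matrix n n ℂ) * (U : Matrix n n ℂ) = 1 := Unitary.coe_star_mul_self U

theorem conjDiagonal_one (U : unitaryGroup n ℂ) : conjDiagonal U (fun _ => 1) = 1 := by
  simp [conjDiagonal]

theorem conjDiagonal_mul (U : unitaryGroup n ℂ) (d e : n → ℝ) :
    conjDiagonal U d * conjDiagonal U e = conjDiagonal U (fun i => d i * e i) := by
  have h : conjDiagonal U d * conjDiagonal U e =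
      (U : Matrix n n ℂ) * diagonal (fun i => (d i : ℂ)) *
        (star (U : Matrix n n ℂ) * (U : Matrix n n ℂ)) * diagonal (fun i => (e i : ℂ)) *
          star (U : Matrix n n ℂ) := by
    simp only [conjDiagonal, Matrix.mul_assoc]
  rw [h, star_mul_unitary, Matrix.mul_one, Matrix.mul_assoc (U : Matrix n n ℂ),
    diagonal_mul_diagonal]
  simp [conjDiagonal]

theorem conjDiagonal_add (U : unitaryGroup n ℂ) (d e : n → ℝ) :
    conjDiagonal U d + conjDiagonal U e = conjDiagonal U (fun i => d i + e i) := by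
  simp only [conjDiagonal, ← Matrix.add_mul, ← Matrix.mul_add, diagonal_add]
  simp

theorem smul_conjDiagonal (c : ℝ) (U : unitaryGroup n ℂ) (d : n → ℝ) :
    c • conjDiagonal U d = conjDiagonal U (fun i => c * d i) := by
  have : (diagonal (fun i => ((c * d i : ℝ) : ℂ)) : Matrix n n ℂ) =
      c • diagonal (fun i => (d i : ℂ)) := by
    ext i j
    by_cases h : i = j <;> simp [h]
  simp only [conjDiagonal, this]
  simp

theorem trace_conjDiagonal (U : unitaryGroup n ℂ) (d : n → ℝ) :
    (conjDiagonal U d).trace = ∑ i, (d i : ℂ) := by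
  rw [conjDiagonal, trace_mul_comm, ← Matrix.mul_assoc, star_mul_unitary, Matrix.one_mul,
    trace_diagonal]

theorem star_mul_conjDiagonal_mul (U V : unitaryGroup n ℂ) (d : n → ℝ) :
    star (V : Matrix n n ℂ) * conjDiagonal U d * (V : Matrix n n ℂ) =
      conjDiagonal (V⁻¹ * U) d := by
  simp [conjDiagonal, Matrix.mul_assoc]

theorem star_mul_conjDiagonal_mul_self (U : unitaryGroup n ℂ) (d : n → ℝ) :
    star (U : Matrix n n ℂ) * conjDiagonal U d * (U : Matrix n n ℂ) =
      diagonal (fun i => (d i : ℂ)) := by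
  rw [star_mul_conjDiagonal_mul]
  simp [conjDiagonal]

theorem conjDiagonal_isHermitian (U : unitaryGroup n ℂ) (d : n → ℝ) :
    (conjDiagonal U d).IsHermitian := by
  have h : (diagonal (fun i => (d i : ℂ)) : Matrix n n ℂ).IsHermitian :=
    isHermitian_diagonal_of_self_adjoint _ (by ext i; simp)
  exact isHermitian_mul_mul_conjTranspose _ h

theorem conjDiagonal_posSemidef (U : unitaryGroup n ℂ) {d : n → ℝ} (hd : ∀ i, 0 ≤ d i) :
    (conjDiagonal U d).PosSemidef := by
  have h : (diagonal (fun i => (d i : ℂ)) : Matrix n n ℂ).PosSemidef :=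
    PosSemidef.diagonal fun i => by simpa using hd i
  exact h.mul_mul_conjTranspose_same _

theorem exists_conjDiagonal {A : Matrix n n ℂ} (hA : A.PosSemidef) :
    ∃ (U : unitaryGroup n ℂ) (d : n → ℝ), (∀ i, 0 ≤ d i) ∧ A = conjDiagonal U d := by
  refine ⟨hA.1.eigenvectorUnitary, hA.1.eigenvalues, hA.eigenvalues_nonneg, ?_⟩
  conv_lhs => rw [hA.1.spectral_theorem]
  rfl

theorem aeval_conjDiagonal (U : unitaryGroup n ℂ) (d : n → ℝ) (q : Polynomial ℝ) :
    Polynomial.aeval (conjDiagonal U d) q = conjDiagonal U (fun i => q.eval (d i)) := by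
  induction q using Polynomial.induction_on' with
  | add p q hp hq => simp [hp, hq, conjDiagonal_add]
  | monomial k c =>
    have hpow : ∀ k : ℕ, conjDiagonal U d ^ k = conjDiagonal U (fun i => d i ^ k) := by
      intro k
      induction k with
      | zero => simp [conjDiagonal_one]
      | succ k ih => rw [pow_succ, ih, conjDiagonal_mul]; simp [pow_succ]
    simp [Polynomial.aeval_monomial, hpow, ← Algebra.smul_def, smul_conjDiagonal]

theorem spectrum_conjDiagonal_subset (U : unitaryGroup n ℂ) (d : n → ℝ) :
    spectrum ℝ (conjDiagonal U d) ⊆ Set.range d := by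
  intro x hx
  by_contra hne
  simp only [Set.mem_range, not_exists] at hne
  refine hx ?_
  have h1 : algebraMap ℝ (Matrix n n ℂ) x - conjDiagonal U d =
      conjDiagonal U (fun i => x - d i) := by
    have := aeval_conjDiagonal U d (Polynomial.C x - Polynomial.X)
    simpa using this
  have h2 : ∀ i, (x - d i) * (x - d i)⁻¹ = 1 := fun i =>
    mul_inv_cancel₀ (sub_ne_zero.2 fun h => hne i h.symm)
  rw [spectrum.mem_resolventSet_iff, h1]
  refine ⟨⟨conjDiagonal U (fun i => x - d i), conjDiagonal U (fun i => (x - d i)⁻¹), ?_, ?_⟩, rfl⟩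
  · rw [conjDiagonal_mul]; simp_rw [h2]; exact conjDiagonal_one U
  · rw [conjDiagonal_mul]; simp_rw [mul_comm _ (x - d _), h2]; exact conjDiagonal_one U

/-- On a finite spectrum the function x ↦ x^r agrees with its Lagrange interpolation polynomial, and
polynomials act on eigenvalues. Zero eigenvalues are allowed: for r ≠ 0 they stay zero, so negative
powers live on the support. -/
theorem conjDiagonal_rpow (U : unitaryGroup n ℂ) {d : n → ℝ} (hd : ∀ i, 0 ≤ d i) (r : ℝ) :
    conjDiagonal U d ^ r = conjDiagonal U (fun i => d i ^ r) := by
  have h0 : (0 : Matrix n n ℂ) ≤ conjDiagonal U d :=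
    nonneg_iff_posSemidef.2 (conjDiagonal_posSemidef U hd)
  let q : Polynomial ℝ := Lagrange.interpolate (Finset.univ.image d) id (fun x => x ^ r)
  have hq : ∀ i, q.eval (d i) = d i ^ r := fun i =>
    Lagrange.eval_interpolate_at_node _ (Set.injOn_id _)
      (Finset.mem_image_of_mem d (Finset.mem_univ i))
  rw [CFC.rpow_eq_cfc_real h0]
  have h1 : cfc (fun x : ℝ => x ^ r) (conjDiagonal U d) = cfc q.eval (conjDiagonal U d) := by
    refine cfc_congr fun x hx => ?_
    obtain ⟨i, rfl⟩ := spectrum_conjDiagonal_subset U d hx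
    exact (hq i).symm
  refine h1.trans ((cfc_polynomial q (conjDiagonal U d) (conjDiagonal_isHermitian U d)).trans ?_)
  rw [aeval_conjDiagonal]
  simp_rw [hq]

theorem rpow_posSemidef (A : Matrix n n ℂ) (r : ℝ) : (A ^ r).PosSemidef :=
  nonneg_iff_posSemidef.1 CFC.rpow_nonneg

theorem zero_rpow_matrix {r : ℝ} (hr : r ≠ 0) : (0 : Matrix n n ℂ) ^ r = 0 := CFC.zero_rpow hr

/-- The trace of the power of a matrix. -/
def tracePow (α : ℝ) (X : Matrix n n ℂ) : ℝ := ((X ^ α).trace).re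

theorem tracePow_conjDiagonal (α : ℝ) (U : unitaryGroup n ℂ) {d : n → ℝ} (hd : ∀ i, 0 ≤ d i) :
    tracePow α (conjDiagonal U d) = ∑ i, d i ^ α := by
  rw [tracePow, conjDiagonal_rpow U hd, trace_conjDiagonal]
  simp

theorem tracePow_nonneg (α : ℝ) (X : Matrix n n ℂ) : 0 ≤ tracePow α X :=
  (Complex.le_def.1 (rpow_posSemidef X α).trace_nonneg).1

theorem tracePow_star_mul_mul (α : ℝ) {X : Matrix n n ℂ} (hX : X.PosSemidef)
    (V : unitaryGroup n ℂ) :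
    tracePow α (star (V : Matrix n n ℂ) * X * (V : Matrix n n ℂ)) = tracePow α X := by
  obtain ⟨U, d, hd, rfl⟩ := exists_conjDiagonal hX
  rw [star_mul_conjDiagonal_mul, tracePow_conjDiagonal α _ hd, tracePow_conjDiagonal α _ hd]

theorem conjDiagonal_apply_self (U : unitaryGroup n ℂ) (d : n → ℝ) (j : n) :
    (conjDiagonal U d j j).re = ∑ i, Complex.normSq ((U : Matrix n n ℂ) j i) * d i := by
  rw [conjDiagonal, Matrix.mul_apply, Complex.re_sum]
  refine Finset.sum_congr rfl fun i _ => ?_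
  rw [mul_diagonal, star_apply, RCLike.star_def, mul_right_comm, Complex.mul_conj]
  simp [← Complex.ofReal_mul]

theorem sum_normSq_row (U : unitaryGroup n ℂ) (j : n) :
    ∑ i, Complex.normSq ((U : Matrix n n ℂ) j i) = 1 := by
  have := conjDiagonal_apply_self U (fun _ => 1) j
  rw [conjDiagonal_one] at this
  simpa using this.symm

theorem sum_normSq_col (U : unitaryGroup n ℂ) (i : n) :
    ∑ j, Complex.normSq ((U : Matrix n n ℂ) j i) = 1 := by
  have := sum_normSq_row U⁻¹ i
  simpa using this

/-- The Peierls inequality for powers. -/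
theorem sum_diag_rpow_le_tracePow {α : ℝ} (hα : 1 ≤ α) {X : Matrix n n ℂ} (hX : X.PosSemidef)
    (V : unitaryGroup n ℂ) :
    ∑ j, ((star (V : Matrix n n ℂ) * X * (V : Matrix n n ℂ)) j j).re ^ α ≤ tracePow α X := by
  obtain ⟨U, d, hd, rfl⟩ := exists_conjDiagonal hX
  rw [star_mul_conjDiagonal_mul, tracePow_conjDiagonal α _ hd]
  set W := V⁻¹ * U
  -- The squared moduli of the entries of `W` are doubly stochastic: row sums give Jensen's
  -- inequality, column sums collapse the double sum.
  calc ∑ j, (conjDiagonal W d j j).re ^ α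
      ≤ ∑ j, ∑ i, Complex.normSq ((W : Matrix n n ℂ) j i) * d i ^ α := by
        refine Finset.sum_le_sum fun j _ => ?_
        rw [conjDiagonal_apply_self]
        exact Real.rpow_arith_mean_le_arith_mean_rpow _ _ _ (fun i _ => Complex.normSq_nonneg _)
          (sum_normSq_row W j) (fun i _ => hd i) hα
    _ = ∑ i, d i ^ α := by
        rw [Finset.sum_comm]
        refine Finset.sum_congr rfl fun i _ => ?_
        rw [← Finset.sum_mul, sum_normSq_col, one_mul]

/-- The equality case of Peierls, attained in an eigenbasis. For α ≥ 1, Tr X^α is therefore a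
maximum over bases of diagonal sums, from which its monotonicity and convexity follow. -/
theorem exists_tracePow_eq_sum_diag (α : ℝ) {X : Matrix n n ℂ} (hX : X.PosSemidef) :
    ∃ V : unitaryGroup n ℂ, tracePow α X =
      ∑ j, ((star (V : Matrix n n ℂ) * X * (V : Matrix n n ℂ)) j j).re ^ α := by
  obtain ⟨U, d, hd, rfl⟩ := exists_conjDiagonal hX
  exact ⟨U, by rw [star_mul_conjDiagonal_mul_self, tracePow_conjDiagonal α _ hd]; simp⟩

theorem diag_re_nonneg {m : Type*} {X : Matrix m m ℂ} (hX : X.PosSemidef) (j : m) :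
    0 ≤ (X j j).re :=
  (Complex.le_def.1 hX.diag_nonneg).1

/-- The trace of a power is monotone and convex. -/
theorem tracePow_le_of_le_add {α : ℝ} (hα : 1 ≤ α) {X Y Z : Matrix n n ℂ} (hX : X.PosSemidef)
    (hY : Y.PosSemidef) (hZ : Z.PosSemidef) {a b : ℝ} (ha : 0 ≤ a) (hb : 0 ≤ b) (hab : a + b = 1)
    (h : Z ≤ a • X + b • Y) : tracePow α Z ≤ a * tracePow α X + b * tracePow α Y := by
  -- In an eigenbasis of `Z` Peierls is an equality for `Z` and an upper bound for `X` and `Y`; what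
  -- remains is scalar convexity entry by entry.
  obtain ⟨V, hV⟩ := exists_tracePow_eq_sum_diag α hZ
  rw [hV]
  calc _ ≤ ∑ j, (a * ((star (V : Matrix n n ℂ) * X * (V : Matrix n n ℂ)) j j).re ^ α +
        b * ((star (V : Matrix n n ℂ) * Y * (V : Matrix n n ℂ)) j j).re ^ α) := by
        refine Finset.sum_le_sum fun j _ => ?_
        have h0 := diag_re_nonneg (hZ.conjTranspose_mul_mul_same (V : Matrix n n ℂ)) j
        have hx := diag_re_nonneg (hX.conjTranspose_mul_mul_same (V : Matrix n n ℂ)) j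
        have hy := diag_re_nonneg (hY.conjTranspose_mul_mul_same (V : Matrix n n ℂ)) j
        have h1 := diag_re_nonneg ((le_iff.1 h).conjTranspose_mul_mul_same (V : Matrix n n ℂ)) j
        have h2 : ((V : Matrix n n ℂ)ᴴ * (a • X + b • Y - Z) * (V : Matrix n n ℂ)) j j =
            a * ((V : Matrix n n ℂ)ᴴ * X * (V : Matrix n n ℂ)) j j +
            b * ((V : Matrix n n ℂ)ᴴ * Y * (V : Matrix n n ℂ)) j j -
            ((V : Matrix n n ℂ)ᴴ * Z * (V : Matrix n n ℂ)) j j := by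
          simp [Matrix.mul_sub, Matrix.sub_mul, Matrix.mul_add, Matrix.add_mul]
        rw [h2] at h1
        simp only [Complex.sub_re, Complex.add_re, Complex.re_ofReal_mul] at h1
        refine (Real.rpow_le_rpow h0 (sub_nonneg.1 h1) (by linarith)).trans ?_
        exact (convexOn_rpow hα).2 hx hy ha hb hab
    _ ≤ _ := by
        rw [Finset.sum_add_distrib, ← Finset.mul_sum, ← Finset.mul_sum]
        exact add_le_add (mul_le_mul_of_nonneg_left (sum_diag_rpow_le_tracePow hα hX V) ha)
          (mul_le_mul_of_nonneg_left (sum_diag_rpow_le_tracePow hα hY V) hb)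

theorem tracePow_mono {α : ℝ} (hα : 1 ≤ α) {X Y : Matrix n n ℂ} (hX : X.PosSemidef)
    (hXY : X ≤ Y) : tracePow α X ≤ tracePow α Y := by
  have hY : Y.PosSemidef := nonneg_iff_posSemidef.1 ((nonneg_iff_posSemidef.2 hX).trans hXY)
  have := tracePow_le_of_le_add hα hY hY hX zero_le_one le_rfl (by norm_num)
    (by simpa using hXY)
  simpa using this

/-- The trace of a power depends only on the characteristic polynomial, which XᴴX and XXᴴ share. -/
theorem tracePow_eq_sum_roots (α : ℝ) {X : Matrix n n ℂ} (hX : X.PosSemidef) :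
    tracePow α X = (X.charpoly.roots.map fun z => z.re ^ α).sum := by
  have h : X = conjDiagonal hX.1.eigenvectorUnitary hX.1.eigenvalues := hX.1.spectral_theorem
  rw [hX.1.roots_charpoly_eq_eigenvalues, Multiset.map_map]
  conv_lhs => rw [h]
  rw [tracePow_conjDiagonal α _ hX.eigenvalues_nonneg]
  exact congrArg Multiset.sum (Multiset.map_congr rfl fun i _ => by simp)

theorem tracePow_conjTranspose_mul_self (α : ℝ) (X : Matrix n n ℂ) :
    tracePow α (Xᴴ * X) = tracePow α (X * Xᴴ) := by
  rw [tracePow_eq_sum_roots α (posSemidef_conjTranspose_mul_self X),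
    tracePow_eq_sum_roots α (posSemidef_self_mul_conjTranspose X), charpoly_mul_comm]

end

/-! ### Operator powers and the quasi-entropy for a full-rank second argument -/

section

variable {n : Type*} [Fintype n] [DecidableEq n]

/-- Splitting x^(-s) into x^s followed by inversion separates two classical facts: x^s is operator
monotone and concave for 0 < s ≤ 1, and inversion is operator antitone and convex. -/
theorem rpow_neg_eq_ringInverse {A : Matrix n n ℂ} (hA : A.PosDef) {s : ℝ} (hs : s ≠ 0) :
    A ^ (-s) = Ring.inverse (A ^ s) := by
  have h := isStrictlyPositive_iff_posDef.2 hA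
  have hs' : IsStrictlyPositive (A ^ s) :=
    (IsStrictlyPositive.iff_of_unital).2
      ⟨CFC.rpow_nonneg, (CFC.isUnit_rpow_iff A s hs h.nonneg).2 h.isUnit⟩
  rw [CFC.inverse_eq_rpow_neg_one hs', CFC.rpow_rpow A s (-1) hs h, mul_neg_one]

theorem rpow_posDef {A : Matrix n n ℂ} (hA : A.PosDef) (s : ℝ) : (A ^ s).PosDef := by
  have h := isStrictlyPositive_iff_posDef.2 hA
  exact isStrictlyPositive_iff_posDef.1
    ((IsStrictlyPositive.iff_of_unital).2 ⟨CFC.rpow_nonneg, h.isUnit.cfcRpow s h.nonneg⟩)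

theorem rpow_neg_antitone {A B : Matrix n n ℂ} (hA : A.PosDef) (hB : B.PosDef) (hAB : A ≤ B)
    {s : ℝ} (hs₀ : 0 < s) (hs₁ : s ≤ 1) : B ^ (-s) ≤ A ^ (-s) := by
  rw [rpow_neg_eq_ringInverse hA hs₀.ne', rpow_neg_eq_ringInverse hB hs₀.ne']
  have h := isStrictlyPositive_iff_posDef.2 (rpow_posDef hA s)
  open scoped Matrix.Norms.L2Operator in
  exact CStarAlgebra.ringInverse_le_ringInverse (CFC.monotone_rpow ⟨hs₀.le, hs₁⟩ hAB) h

/-- Concavity of x^s bounds the power of the mean below by the mean of powers; inversion reverses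
this, and convexity of inversion finishes. -/
theorem rpow_neg_convex {A B : Matrix n n ℂ} (hA : A.PosDef) (hB : B.PosDef) {s : ℝ}
    (hs₀ : 0 < s) (hs₁ : s ≤ 1) {a b : ℝ} (ha : 0 < a) (hb : 0 < b) (hab : a + b = 1) :
    (a • A + b • B) ^ (-s) ≤ a • A ^ (-s) + b • B ^ (-s) := by
  have hAB : (a • A + b • B).PosDef := (hA.smul ha).add (hB.smul hb)
  have hs : (a • A ^ s + b • B ^ s).PosDef :=
    ((rpow_posDef hA s).smul ha).add ((rpow_posDef hB s).smul hb)
  rw [rpow_neg_eq_ringInverse hA hs₀.ne', rpow_neg_eq_ringInverse hB hs₀.ne',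
    rpow_neg_eq_ringInverse hAB hs₀.ne']
  have h1 : a • A ^ s + b • B ^ s ≤ (a • A + b • B) ^ s := by
    open scoped Matrix.Norms.L2Operator in
    exact (CFC.concaveOn_rpow ⟨hs₀.le, hs₁⟩).2 (nonneg_iff_posSemidef.2 hA.posSemidef)
      (nonneg_iff_posSemidef.2 hB.posSemidef) ha.le hb.le hab
  have h2 : Ring.inverse ((a • A + b • B) ^ s) ≤ Ring.inverse (a • A ^ s + b • B ^ s) := by
    open scoped Matrix.Norms.L2Operator in
    exact CStarAlgebra.ringInverse_le_ringInverse h1 (isStrictlyPositive_iff_posDef.2 hs)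
  refine h2.trans ?_
  open scoped Matrix.Norms.L2Operator in
  exact CStarAlgebra.convexOn_ringInverse.2 (isStrictlyPositive_iff_posDef.2 (rpow_posDef hA s))
    (isStrictlyPositive_iff_posDef.2 (rpow_posDef hB s)) ha.le hb.le hab

theorem continuousOn_rpow_posDef (r : ℝ) :
    ContinuousOn (fun A : Matrix n n ℂ => A ^ r) {A | A.PosDef} := by
  have h : ContinuousOn (fun A : Matrix n n ℂ => cfc (fun x : ℝ => x ^ r) A)
      {A | A.PosDef} := by
    open scoped Matrix.Norms.L2Operator in
    refine ContinuousOn.cfc_of_mem_nhdsSet (s := Set.Ioi 0) _ ?_ continuousOn_id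
      (fun A hA => hA.1) (fun x hx => ((Real.continuousAt_rpow_const x r
        (Or.inl (ne_of_gt hx))).continuousWithinAt))
    refine isOpen_Ioi.mem_nhdsSet.2 ?_
    refine Set.iUnion₂_subset fun A hA x hx => ?_
    exact (isStrictlyPositive_iff_posDef.2 hA).spectrum_pos hx
  exact h.congr fun A hA => CFC.rpow_eq_cfc_real (nonneg_iff_posSemidef.2 hA.posSemidef)

theorem continuousOn_rpow_posSemidef {r : ℝ} (hr : 0 ≤ r) :
    ContinuousOn (fun A : Matrix n n ℂ => A ^ r) {A | A.PosSemidef} := by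
  open scoped Matrix.Norms.L2Operator in
  refine ContinuousOn.cfc_nnreal_of_mem_nhdsSet (s := Set.univ) (fun x => x ^ r)
    Filter.univ_mem continuousOn_id
    (fun A hA => nonneg_iff_posSemidef.2 hA) (NNReal.continuous_rpow_const hr).continuousOn

theorem continuousOn_tracePow {α : ℝ} (hα : 0 ≤ α) :
    ContinuousOn (fun A : Matrix n n ℂ => tracePow α A) {A | A.PosSemidef} :=
  (Complex.continuous_re.comp continuous_id.matrix_trace).comp_continuousOn
    (continuousOn_rpow_posSemidef hα)

theorem supp_le_supp_iff {A B : Matrix n n ℂ} :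
    supp A ≤ supp B ↔ ∀ v : n → ℂ, B *ᵥ v = 0 → A *ᵥ v = 0 := by
  rw [supp, supp, Submodule.orthogonal_le_orthogonal_iff]
  constructor
  · intro h v hv
    have := @h (WithLp.toLp 2 v) (by simp [hv])
    simpa using this
  · intro h v hv
    have := h v.ofLp (by simpa [toLpLin_apply] using hv)
    simp [toLpLin_apply, this]

theorem supp_le_supp_of_posDef (A : Matrix n n ℂ) {B : Matrix n n ℂ} (hB : B.PosDef) :
    supp A ≤ supp B :=
  supp_le_supp_iff.2 fun v hv => by
    have : v = 0 := by
      by_contra hne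
      have := hB.dotProduct_mulVec_pos hne
      simp [hv] at this
    simp [this]

theorem sandwiched_posSemidef {A : Matrix n n ℂ} (hA : A.PosSemidef) (B : Matrix n n ℂ) (r : ℝ) :
    (B ^ r * A * B ^ r).PosSemidef := by
  have := hA.mul_mul_conjTranspose_same (B ^ r)
  rwa [(rpow_posSemidef B r).1.eq] at this

theorem sandwichedQ_of_supp_le {α : ℝ} {A B : Matrix n n ℂ} (h : supp A ≤ supp B) :
    sandwichedQ α A B = ENNReal.ofReal
      (tracePow α (B ^ ((1 - α) / (2 * α)) * A * B ^ ((1 - α) / (2 * α)))) := by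
  rw [sandwichedQ, if_pos h, tracePow]

/-- The two sides are XᴴX and XXᴴ for X = A^(1/2) B^r. The new form contains a single power of B, so
operator inequalities for that power apply directly. -/
theorem tracePow_sandwiched {α : ℝ} {A B : Matrix n n ℂ} (hA : A.PosSemidef) (hB : B.PosDef)
    (r : ℝ) : tracePow α (B ^ r * A * B ^ r) =
      tracePow α (A ^ (1 / 2 : ℝ) * B ^ (2 * r) * A ^ (1 / 2 : ℝ)) := by
  have h1 : A ^ (1 / 2 : ℝ) * A ^ (1 / 2 : ℝ) = A := by
    rw [← CFC.sqrt_eq_rpow]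
    exact CFC.sqrt_mul_sqrt_self A (nonneg_iff_posSemidef.2 hA)
  have h2 : B ^ r * B ^ r = B ^ (2 * r) := by
    rw [two_mul, CFC.rpow_add (isStrictlyPositive_iff_posDef.2 hB).isUnit]
  have h := tracePow_conjTranspose_mul_self α (A ^ (1 / 2 : ℝ) * B ^ r)
  rw [conjTranspose_mul, (rpow_posSemidef A _).1.eq, (rpow_posSemidef B _).1.eq] at h
  calc _ = tracePow α (B ^ r * A ^ (1 / 2 : ℝ) * (A ^ (1 / 2 : ℝ) * B ^ r)) := by
        simp only [Matrix.mul_assoc]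
        rw [← Matrix.mul_assoc (A ^ (1 / 2 : ℝ)) (A ^ (1 / 2 : ℝ)), h1]
    _ = _ := by
        rw [h, Matrix.mul_assoc, ← Matrix.mul_assoc (B ^ r), h2, Matrix.mul_assoc]

theorem sandwichedQ_of_posDef {α : ℝ} {A B : Matrix n n ℂ} (hα : 1 < α) (hA : A.PosSemidef)
    (hB : B.PosDef) : sandwichedQ α A B = ENNReal.ofReal
      (tracePow α (A ^ (1 / 2 : ℝ) * B ^ (-((α - 1) / α)) * A ^ (1 / 2 : ℝ))) := by
  rw [sandwichedQ_of_supp_le (supp_le_supp_of_posDef A hB), tracePow_sandwiched hA hB]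
  congr 5
  field_simp
  ring

theorem half_sandwich_mono {A X Y : Matrix n n ℂ} (h : X ≤ Y) :
    A ^ (1 / 2 : ℝ) * X * A ^ (1 / 2 : ℝ) ≤ A ^ (1 / 2 : ℝ) * Y * A ^ (1 / 2 : ℝ) := by
  have := (le_iff.1 h).mul_mul_conjTranspose_same (A ^ (1 / 2 : ℝ))
  rw [(rpow_posSemidef A _).1.eq, Matrix.mul_sub, Matrix.sub_mul] at this
  exact this

theorem half_sandwich_posSemidef (A B : Matrix n n ℂ) (r : ℝ) :
    (A ^ (1 / 2 : ℝ) * B ^ r * A ^ (1 / 2 : ℝ)).PosSemidef :=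
  sandwiched_posSemidef (rpow_posSemidef B r) A _

theorem sandwichedQ_antitone {α : ℝ} (hα : 1 < α) {A B C : Matrix n n ℂ} (hA : A.PosSemidef)
    (hB : B.PosDef) (hC : C.PosDef) (hBC : B ≤ C) : sandwichedQ α A C ≤ sandwichedQ α A B := by
  rw [sandwichedQ_of_posDef hα hA hB, sandwichedQ_of_posDef hα hA hC]
  refine ENNReal.ofReal_le_ofReal (tracePow_mono hα.le (half_sandwich_posSemidef _ _ _) ?_)
  exact half_sandwich_mono (rpow_neg_antitone hB hC hBC (div_pos (by linarith) (by linarith))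
    ((div_le_one (by linarith)).2 (by linarith)))

theorem sandwichedQ_convex_of_posDef {α : ℝ} (hα : 1 < α) {A B C : Matrix n n ℂ}
    (hA : A.PosSemidef) (hB : B.PosDef) (hC : C.PosDef) {a b : ℝ} (ha : 0 < a) (hb : 0 < b)
    (hab : a + b = 1) : sandwichedQ α A (a • B + b • C) ≤
      ENNReal.ofReal a * sandwichedQ α A B + ENNReal.ofReal b * sandwichedQ α A C := by
  rw [sandwichedQ_of_posDef hα hA hB, sandwichedQ_of_posDef hα hA hC,
    sandwichedQ_of_posDef hα hA ((hB.smul ha).add (hC.smul hb)), ← ENNReal.ofReal_mul ha.le,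
    ← ENNReal.ofReal_mul hb.le, ← ENNReal.ofReal_add (mul_nonneg ha.le (tracePow_nonneg _ _))
      (mul_nonneg hb.le (tracePow_nonneg _ _))]
  refine ENNReal.ofReal_le_ofReal (tracePow_le_of_le_add hα.le (half_sandwich_posSemidef _ _ _)
    (half_sandwich_posSemidef _ _ _) (half_sandwich_posSemidef _ _ _) ha.le hb.le hab ?_)
  have := half_sandwich_mono (A := A) (rpow_neg_convex hB hC (s := (α - 1) / α)
    (div_pos (by linarith) (by linarith)) ((div_le_one (by linarith)).2 (by linarith)) ha hb hab)
  simpa [Matrix.mul_add, Matrix.add_mul] using this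

theorem continuousOn_sandwichedQ {α : ℝ} (hα : 1 < α) {A : Matrix n n ℂ} (hA : A.PosSemidef) :
    ContinuousOn (fun B => sandwichedQ α A B) {B | B.PosDef} := by
  have h : ContinuousOn (fun B : Matrix n n ℂ => ENNReal.ofReal
      (tracePow α (B ^ ((1 - α) / (2 * α)) * A * B ^ ((1 - α) / (2 * α))))) {B | B.PosDef} := by
    refine ENNReal.continuous_ofReal.comp_continuousOn
      ((continuousOn_tracePow (by linarith)).comp ?_ fun B _ => sandwiched_posSemidef hA B _)
    exact ((continuousOn_rpow_posDef _).mul continuousOn_const).mul (continuousOn_rpow_posDef _)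
  exact h.congr fun B hB => sandwichedQ_of_supp_le (supp_le_supp_of_posDef A hB)

/-- With B fixed the sandwich is linear in A, so B may be singular as long as the support condition
holds. -/
theorem continuousOn_sandwichedQ_left {α : ℝ} (hα : 1 < α) (B : Matrix n n ℂ) :
    ContinuousOn (fun A => sandwichedQ α A B) {A | A.PosSemidef ∧ supp A ≤ supp B} := by
  have h : ContinuousOn (fun A : Matrix n n ℂ => ENNReal.ofReal
      (tracePow α (B ^ ((1 - α) / (2 * α)) * A * B ^ ((1 - α) / (2 * α)))))
      {A | A.PosSemidef ∧ supp A ≤ supp B} := by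
    refine ENNReal.continuous_ofReal.comp_continuousOn
      ((continuousOn_tracePow (by linarith)).comp ?_ fun A hA => sandwiched_posSemidef hA.1 B _)
    exact ((continuous_const.matrix_mul continuous_id).matrix_mul continuous_const).continuousOn
  exact h.congr fun A hA => sandwichedQ_of_supp_le hA.2

end

/-! ### Singular second arguments by regularisation -/

section

variable {n : Type*} [Fintype n] [DecidableEq n]

theorem conjDiagonal_add_smul_one (U : unitaryGroup n ℂ) (d : n → ℝ) (ε : ℝ) :
    conjDiagonal U d + ε • (1 : Matrix n n ℂ) = conjDiagonal U (fun i => d i + ε) := by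
  rw [← conjDiagonal_one U, smul_conjDiagonal, conjDiagonal_add]
  simp

theorem posDef_add_smul_one {m : Type*} [DecidableEq m] {B : Matrix m m ℂ}
    (hB : B.PosSemidef) {ε : ℝ} (hε : 0 < ε) :
    (B + ε • (1 : Matrix m m ℂ)).PosDef :=
  PosDef.posSemidef_add hB (PosDef.one.smul hε)

/-- The sandwich of `A` by `conjDiagonal U d`, in the basis given by `U`. -/
def eigenSandwich (r : ℝ) (R : Matrix n n ℂ) (d : n → ℝ) : Matrix n n ℂ :=
  diagonal (fun i => ((d i ^ r : ℝ) : ℂ)) * R * diagonal (fun i => ((d i ^ r : ℝ) : ℂ))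

theorem eigenSandwich_apply (r : ℝ) (R : Matrix n n ℂ) (d : n → ℝ) (i j : n) :
    eigenSandwich r R d i j = ((d i ^ r : ℝ) : ℂ) * R i j * ((d j ^ r : ℝ) : ℂ) := by
  rw [eigenSandwich, mul_diagonal, diagonal_mul]

theorem eigenSandwich_posSemidef (r : ℝ) {R : Matrix n n ℂ} (hR : R.PosSemidef) (d : n → ℝ) :
    (eigenSandwich r R d).PosSemidef := by
  have := hR.mul_mul_conjTranspose_same (diagonal (fun i => ((d i ^ r : ℝ) : ℂ)))
  rw [diagonal_conjTranspose] at this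
  convert this using 1
  rw [eigenSandwich]
  congr 2
  ext i
  simp

theorem tracePow_sandwiched_conjDiagonal (α r : ℝ) {A : Matrix n n ℂ} (hA : A.PosSemidef)
    (U : unitaryGroup n ℂ) {d : n → ℝ} (hd : ∀ i, 0 ≤ d i) :
    tracePow α (conjDiagonal U d ^ r * A * conjDiagonal U d ^ r) =
      tracePow α (eigenSandwich r (star (U : Matrix n n ℂ) * A * (U : Matrix n n ℂ)) d) := by
  rw [← tracePow_star_mul_mul α (sandwiched_posSemidef hA _ r) U, conjDiagonal_rpow U hd]
  congr 1
  rw [eigenSandwich, conjDiagonal]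
  simp only [← Matrix.mul_assoc]
  rw [star_mul_unitary, Matrix.one_mul]
  simp only [Matrix.mul_assoc]
  rw [star_mul_unitary, Matrix.mul_one]

theorem conjDiagonal_mulVec_eq_zero_iff (U : unitaryGroup n ℂ) (d : n → ℝ) (v : n → ℂ) :
    conjDiagonal U d *ᵥ v = 0 ↔ ∀ i, (d i : ℂ) * (star (U : Matrix n n ℂ) *ᵥ v) i = 0 := by
  have h1 : conjDiagonal U d *ᵥ v = (U : Matrix n n ℂ) *ᵥ
      (diagonal (fun i => (d i : ℂ)) *ᵥ (star (U : Matrix n n ℂ) *ᵥ v)) := by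
    simp [conjDiagonal, Matrix.mul_assoc]
  rw [h1]
  constructor
  · intro h i
    have h2 := congrArg (fun w => star (U : Matrix n n ℂ) *ᵥ w) h
    simp only [mulVec_mulVec, ← Matrix.mul_assoc, star_mul_unitary, Matrix.one_mul,
      mulVec_zero] at h2
    have := congrFun h2 i
    rwa [← mulVec_mulVec, mulVec_diagonal] at this
  · intro h
    have : diagonal (fun i => (d i : ℂ)) *ᵥ (star (U : Matrix n n ℂ) *ᵥ v) = 0 := by
      ext i
      rw [mulVec_diagonal]
      exact h i
    rw [this, mulVec_zero]

/-- For positive semidefinite R, ⟨e_i, R e_i⟩ = 0 forces R e_i = 0. -/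
theorem PosSemidef.apply_eq_zero_of_diag {R : Matrix n n ℂ} (hR : R.PosSemidef) {i : n}
    (h : R i i = 0) (j : n) : R j i = 0 := by
  have h1 : R *ᵥ Pi.single i 1 = 0 := by
    refine (hR.dotProduct_mulVec_zero_iff _).1 ?_
    have : star (Pi.single i 1 : n → ℂ) = Pi.single i 1 := by
      ext k
      by_cases hk : k = i
      · subst hk; simp
      · simp [hk]
    simp [this, h]
  simpa using congrFun h1 j

theorem supp_le_supp_conjDiagonal_iff {A : Matrix n n ℂ} (hA : A.PosSemidef)
    (U : unitaryGroup n ℂ) (d : n → ℝ) :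
    supp A ≤ supp (conjDiagonal U d) ↔
      ∀ i, d i = 0 → (star (U : Matrix n n ℂ) * A * (U : Matrix n n ℂ)) i i = 0 := by
  rw [supp_le_supp_iff]
  constructor
  · intro h i hi
    have h1 := h ((U : Matrix n n ℂ) *ᵥ Pi.single i 1) <|
      (conjDiagonal_mulVec_eq_zero_iff U d _).2 fun j => by
        rw [mulVec_mulVec, star_mul_unitary, one_mulVec]
        by_cases hj : j = i
        · subst hj; simp [hi]
        · simp [hj]
    have h2 := congrArg (fun w => star (U : Matrix n n ℂ) *ᵥ w) h1
    simp only [mulVec_mulVec, mulVec_zero, ← Matrix.mul_assoc] at h2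
    simpa using congrFun h2 i
  · intro h v hv
    rw [conjDiagonal_mulVec_eq_zero_iff] at hv
    have hR : (star (U : Matrix n n ℂ) * A * (U : Matrix n n ℂ)).PosSemidef :=
      hA.conjTranspose_mul_mul_same _
    have h1 : (star (U : Matrix n n ℂ) * A * (U : Matrix n n ℂ)) *ᵥ
        (star (U : Matrix n n ℂ) *ᵥ v) = 0 := by
      ext j
      rw [mulVec, dotProduct, Pi.zero_apply]
      refine Finset.sum_eq_zero fun i _ => ?_
      rcases eq_or_ne (d i) 0 with hi | hi
      · rw [PosSemidef.apply_eq_zero_of_diag hR (h i hi), zero_mul]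
      · have := (mul_eq_zero.1 (hv i)).resolve_left (by exact_mod_cast hi)
        rw [this, mul_zero]
    have h2 : A = (U : Matrix n n ℂ) * (star (U : Matrix n n ℂ) * A * (U : Matrix n n ℂ)) *
        star (U : Matrix n n ℂ) := by
      rw [Matrix.mul_assoc (star (U : Matrix n n ℂ)), ← Matrix.mul_assoc, unitary_mul_star,
        Matrix.one_mul, Matrix.mul_assoc, unitary_mul_star, Matrix.mul_one]
    rw [h2, ← mulVec_mulVec, ← mulVec_mulVec, h1, mulVec_zero]

/-- In an eigenbasis of B the sandwich has entries (d_i + ε)^r R_ij (d_j + ε)^r with r < 0. If the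
supports are nested, the rows and columns of R with d_i = 0 vanish and the rest converges. Otherwise
some d_i = 0 has R_ii > 0, and that diagonal entry blows up. -/
theorem tendsto_sandwichedQ_add_smul_one {α : ℝ} (hα : 1 < α) {A B : Matrix n n ℂ}
    (hA : A.PosSemidef) (hB : B.PosSemidef) :
    Tendsto (fun ε : ℝ => sandwichedQ α A (B + ε • (1 : Matrix n n ℂ))) (𝓝[>] 0)
      (𝓝 (sandwichedQ α A B)) := by
  obtain ⟨U, d, hd, rfl⟩ := exists_conjDiagonal hB
  set R := star (U : Matrix n n ℂ) * A * (U : Matrix n n ℂ) with hRdef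
  have hR : R.PosSemidef := hA.conjTranspose_mul_mul_same _
  set r := (1 - α) / (2 * α) with hr
  have hr0 : r < 0 := div_neg_of_neg_of_pos (by linarith) (by linarith)
  have hQ : (fun ε : ℝ => ENNReal.ofReal (tracePow α (eigenSandwich r R fun i => d i + ε)))
      =ᶠ[𝓝[>] 0] fun ε : ℝ => sandwichedQ α A (conjDiagonal U d + ε • (1 : Matrix n n ℂ)) := by
    filter_upwards [self_mem_nhdsWithin] with ε hε
    have hε : 0 < ε := hε
    rw [sandwichedQ_of_supp_le (supp_le_supp_of_posDef A (posDef_add_smul_one hB hε)),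
      conjDiagonal_add_smul_one, tracePow_sandwiched_conjDiagonal α _ hA U]
    exact fun i => by linarith [hd i]
  refine Tendsto.congr' hQ ?_
  by_cases hs : supp A ≤ supp (conjDiagonal U d)
  · rw [sandwichedQ_of_supp_le hs, tracePow_sandwiched_conjDiagonal α _ hA U hd]
    rw [supp_le_supp_conjDiagonal_iff hA] at hs
    refine (ENNReal.continuous_ofReal.tendsto _).comp ?_
    refine (continuousOn_tracePow (by linarith : 0 ≤ α) _
      (eigenSandwich_posSemidef r hR d)).tendsto.comp
      (tendsto_nhdsWithin_iff.2 ⟨?_, Eventually.of_forall fun ε => eigenSandwich_posSemidef r hR _⟩)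
    refine tendsto_pi_nhds.2 fun i => tendsto_pi_nhds.2 fun j => ?_
    simp only [eigenSandwich_apply]
    have hlim : ∀ i, d i ≠ 0 → Tendsto (fun ε : ℝ => (((d i + ε) ^ r : ℝ) : ℂ)) (𝓝[>] 0)
        (𝓝 ((d i ^ r : ℝ) : ℂ)) := fun i hi => by
      refine (Complex.continuous_ofReal.tendsto _).comp ?_
      have h1 : Tendsto (fun ε : ℝ => d i + ε) (𝓝[>] 0) (𝓝 (d i)) := by
        have : Tendsto (fun ε : ℝ => d i + ε) (𝓝 0) (𝓝 (d i + 0)) :=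
          (continuous_const.add continuous_id).tendsto 0
        rw [add_zero] at this
        exact this.mono_left nhdsWithin_le_nhds
      exact h1.rpow_const (Or.inl hi)
    rcases eq_or_ne (d i) 0 with hi | hi
    · have h0 : R i j = 0 := by
        have := PosSemidef.apply_eq_zero_of_diag hR (hs i hi) j
        rw [← hR.1.apply, this, star_zero]
      simp [h0]
    rcases eq_or_ne (d j) 0 with hj | hj
    · simp [PosSemidef.apply_eq_zero_of_diag hR (hs j hj) i]
    exact ((hlim i hi).mul tendsto_const_nhds).mul (hlim j hj)
  · rw [sandwichedQ, if_neg hs]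
    rw [supp_le_supp_conjDiagonal_iff hA] at hs
    push Not at hs
    obtain ⟨i, hi, hRi⟩ := hs
    have hpos : 0 < (R i i).re := by
      refine lt_of_le_of_ne (diag_re_nonneg hR i) fun h => hRi ?_
      exact Complex.ext h.symm (Complex.le_def.1 (hR.diag_nonneg (i := i))).2.symm
    have hbound : ∀ ε : ℝ, 0 < ε → (ε ^ r * (R i i).re * ε ^ r) ^ α ≤
        tracePow α (eigenSandwich r R fun i => d i + ε) := fun ε hε => by
      -- Peierls in the standard basis, keeping only the `i`-th term.
      have hM := eigenSandwich_posSemidef r hR fun i => d i + ε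
      refine le_trans ?_ (sum_diag_rpow_le_tracePow hα.le hM 1)
      have h1 : ((eigenSandwich r R fun i => d i + ε) i i).re = ε ^ r * (R i i).re * ε ^ r := by
        rw [eigenSandwich_apply, hi, zero_add, Complex.re_mul_ofReal, Complex.re_ofReal_mul]
      rw [← h1]
      simp only [OneMemClass.coe_one, star_one, Matrix.one_mul, Matrix.mul_one]
      exact Finset.single_le_sum (f := fun j => ((eigenSandwich r R fun i => d i + ε) j j).re ^ α)
        (fun j _ => Real.rpow_nonneg (diag_re_nonneg hM j) _) (Finset.mem_univ i)
    have ht : Tendsto (fun ε : ℝ => (ε ^ r * (R i i).re * ε ^ r) ^ α) (𝓝[>] 0) atTop := by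
      have h1 := tendsto_rpow_neg_nhdsGT_zero hr0
      exact (tendsto_rpow_atTop (by linarith)).comp ((h1.atTop_mul_const hpos).atTop_mul_atTop₀ h1)
    refine ENNReal.tendsto_ofReal_atTop.comp (tendsto_atTop_mono' _ ?_ ht)
    filter_upwards [self_mem_nhdsWithin] with ε hε using hbound ε hε

/-- By antitonicity the regularised values grow as ε decreases, so each is at most their limit. -/
theorem sandwichedQ_add_smul_one_le {α : ℝ} (hα : 1 < α) {A B : Matrix n n ℂ}
    (hA : A.PosSemidef) (hB : B.PosSemidef) {ε : ℝ} (hε : 0 < ε) :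
    sandwichedQ α A (B + ε • (1 : Matrix n n ℂ)) ≤ sandwichedQ α A B := by
  refine ge_of_tendsto (tendsto_sandwichedQ_add_smul_one hα hA hB) ?_
  filter_upwards [Ioo_mem_nhdsGT hε] with δ hδ
  refine sandwichedQ_antitone hα hA (posDef_add_smul_one hB hδ.1) (posDef_add_smul_one hB hε) ?_
  have h : (B + ε • (1 : Matrix n n ℂ)) - (B + δ • (1 : Matrix n n ℂ)) =
      (ε - δ) • (1 : Matrix n n ℂ) := by
    rw [sub_smul]; abel
  rw [le_iff, h]
  exact PosSemidef.one.smul (sub_nonneg.2 hδ.2.le)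

/-- Convexity of the sandwiched quasi-relative entropy in the second argument. -/
theorem sandwichedQ_convex {α : ℝ} (hα : 1 < α) {A B C : Matrix n n ℂ}
    (hA : A.PosSemidef) (hB : B.PosSemidef) (hC : C.PosSemidef) {a b : ℝ} (ha : 0 < a) (hb : 0 < b)
    (hab : a + b = 1) : sandwichedQ α A (a • B + b • C) ≤
      ENNReal.ofReal a * sandwichedQ α A B + ENNReal.ofReal b * sandwichedQ α A C := by
  refine le_of_tendsto_of_tendsto
    (tendsto_sandwichedQ_add_smul_one hα hA ((hB.smul ha.le).add (hC.smul hb.le)))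
    ((ENNReal.Tendsto.const_mul (tendsto_sandwichedQ_add_smul_one hα hA hB)
      (Or.inr ENNReal.ofReal_ne_top)).add
     (ENNReal.Tendsto.const_mul (tendsto_sandwichedQ_add_smul_one hα hA hC)
      (Or.inr ENNReal.ofReal_ne_top))) ?_
  filter_upwards [self_mem_nhdsWithin] with ε hε
  have h : a • B + b • C + ε • (1 : Matrix n n ℂ) =
      a • (B + ε • (1 : Matrix n n ℂ)) + b • (C + ε • (1 : Matrix n n ℂ)) := by
    have : a • ε • (1 : Matrix n n ℂ) + b • ε • (1 : Matrix n n ℂ) = ε • (1 : Matrix n n ℂ) := by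
      rw [← add_smul, hab, one_smul]
    rw [smul_add, smul_add, add_add_add_comm, this]
  rw [h]
  exact sandwichedQ_convex_of_posDef hα hA (posDef_add_smul_one hB hε)
    (posDef_add_smul_one hC hε) ha hb hab

/-- Lower semicontinuity of the sandwiched quasi-relative entropy in the second argument. -/
theorem lowerSemicontinuousOn_sandwichedQ {α : ℝ} (hα : 1 < α) {A : Matrix n n ℂ}
    (hA : A.PosSemidef) :
    LowerSemicontinuousOn (fun B => sandwichedQ α A B) {B | B.PosSemidef} := by
  intro B hB y hy
  -- Q is bounded below by each regularisation, and these are continuous; one of them already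
  -- exceeds `y` at `B`, hence also near `B`.
  obtain ⟨ε, hyε, hε⟩ := (((tendsto_sandwichedQ_add_smul_one hα hA hB).eventually
    (lt_mem_nhds hy)).and self_mem_nhdsWithin).exists
  have hc : ContinuousOn (fun C : Matrix n n ℂ => sandwichedQ α A (C + ε • (1 : Matrix n n ℂ)))
      {B | B.PosSemidef} :=
    (continuousOn_sandwichedQ hα hA).comp (continuous_id.add continuous_const).continuousOn
      fun C hC => posDef_add_smul_one hC hε
  filter_upwards [(hc B hB).eventually (lt_mem_nhds hyε), self_mem_nhdsWithin] with C hC hC'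
  exact lt_of_lt_of_le hC (sandwichedQ_add_smul_one_le hα hA hC' hε)

end

/-! ### A minimax theorem with attained extrema -/

section

/-- If convex functions `g i` on a convex set satisfy `v ≤ maxᵢ g i` there, then some convex
combination of them is bounded below by `v`. -/
theorem exists_weights_le_sum {W ι : Type*} [AddCommGroup W] [Module ℝ W] [Fintype ι]
    {s : Set W} (hs : s.Nonempty) {g : ι → W → ℝ} (hg : ∀ i, ConvexOn ℝ s (g i)) {v : ℝ}
    (hv : ∀ σ ∈ s, ∃ i, v ≤ g i σ) :
    ∃ p : ι → ℝ, (∀ i, 0 ≤ p i) ∧ ∑ i, p i = 1 ∧ ∀ σ ∈ s, v ≤ ∑ i, p i * g i σ := by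
  classical
  obtain ⟨τ, hτ⟩ := hs
  have hsc : Convex ℝ s := (hg (hv τ hτ).choose).1
  -- `A` collects the vectors dominating some (g_i σ)_i, and is convex because the g_i are; `B` is
  -- the open orthant below v. A hyperplane separating them supplies the weights after
  -- normalisation.
  let A : Set (ι → ℝ) := {w | ∃ σ ∈ s, ∀ i, g i σ ≤ w i}
  let B : Set (ι → ℝ) := Set.univ.pi fun _ => Set.Iio v
  have hA : Convex ℝ A := by
    rintro w ⟨σ, hσ, hw⟩ w' ⟨σ', hσ', hw'⟩ a b ha hb hab
    refine ⟨a • σ + b • σ', hsc hσ hσ' ha hb hab, fun i => ?_⟩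
    refine ((hg i).2 hσ hσ' ha hb hab).trans ?_
    exact add_le_add (mul_le_mul_of_nonneg_left (hw i) ha) (mul_le_mul_of_nonneg_left (hw' i) hb)
  have hB : Convex ℝ B := convex_pi fun _ _ => convex_Iio v
  have hBo : IsOpen B := isOpen_set_pi Set.finite_univ fun _ _ => isOpen_Iio
  have hdisj : Disjoint B A := by
    rw [Set.disjoint_left]
    rintro w hw ⟨σ, hσ, hwσ⟩
    obtain ⟨i, hi⟩ := hv σ hσ
    exact absurd (hw i (Set.mem_univ i)) (not_lt.2 (hi.trans (hwσ i)))
  obtain ⟨φ, u, hφB, hφA⟩ := geometric_hahn_banach_open hB hBo hA hdisj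
  let c : ι → ℝ := fun i => φ (Pi.single i 1)
  have hφ : ∀ w, φ w = ∑ i, c i * w i := fun w => by
    conv_lhs => rw [pi_eq_sum_univ' w]
    rw [map_sum]
    refine Finset.sum_congr rfl fun i _ => ?_
    rw [map_smul, smul_eq_mul, mul_comm]
  -- `B` is unbounded downwards in each coordinate, so a negative c_i would make φ unbounded above
  -- on it. The step (u - φ b₀)/(-c_i) is the one at which φ reaches exactly u.
  have hc : ∀ i, 0 ≤ c i := by
    intro i
    by_contra hi
    push Not at hi
    let b₀ : ι → ℝ := fun _ => v - 1
    have hb₀ : φ b₀ < u := hφB _ fun j _ => show v - 1 < v by linarith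
    have ht : 0 < (u - φ b₀) / (-c i) := div_pos (by linarith) (by linarith)
    have h1 := hφB (b₀ - ((u - φ b₀) / (-c i)) • Pi.single i 1) fun j _ => by
      have : 0 ≤ (Pi.single i 1 : ι → ℝ) j := by
        by_cases h : j = i
        · subst h; simp
        · simp [h]
      show v - 1 - ((u - φ b₀) / (-c i)) * (Pi.single i 1 : ι → ℝ) j < v
      nlinarith [mul_nonneg ht.le this]
    rw [map_sub, map_smul, smul_eq_mul] at h1
    have h2 : (u - φ b₀) / (-c i) * φ (Pi.single i 1) = -(u - φ b₀) := by
      change (u - φ b₀) / (-c i) * c i = _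
      rw [div_mul_eq_mul_div, mul_div_assoc, div_neg, div_self hi.ne, mul_neg_one]
    rw [h2] at h1
    linarith
  have hgA : ∀ σ ∈ s, u ≤ ∑ i, c i * g i σ := fun σ hσ => by
    rw [← hφ (fun i => g i σ)]
    exact hφA _ ⟨σ, hσ, fun i => le_rfl⟩
  have hBv : ∀ δ > 0, (v - δ) * ∑ i, c i < u := fun δ hδ => by
    have := hφB (fun _ => v - δ) fun j _ => show v - δ < v by linarith
    rwa [hφ, ← Finset.sum_mul, mul_comm] at this
  -- If all c_i vanished, φ = 0 would give both u ≤ 0 and 0 < u.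
  have hS : 0 < ∑ i, c i := by
    refine lt_of_le_of_ne (Finset.sum_nonneg fun i _ => hc i) fun h0 => ?_
    have hz : ∀ i, c i = 0 := fun i =>
      (Finset.sum_eq_zero_iff_of_nonneg fun i _ => hc i).1 h0.symm i (Finset.mem_univ i)
    have h1 := hgA τ hτ
    have h2 := hBv 1 one_pos
    simp only [hz, zero_mul, Finset.sum_const_zero, mul_zero] at h1 h2
    linarith
  have hvS : v * ∑ i, c i ≤ u := by
    refine le_of_forall_pos_le_add fun ε hε => ?_
    have := hBv (ε / ∑ i, c i) (div_pos hε hS)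
    rw [sub_mul, div_mul_cancel₀ _ hS.ne'] at this
    linarith
  refine ⟨fun i => c i / ∑ i, c i, fun i => div_nonneg (hc i) hS.le, ?_, fun σ hσ => ?_⟩
  · rw [← Finset.sum_div, div_self hS.ne']
  · simp_rw [div_mul_eq_mul_div]
    rw [← Finset.sum_div, le_div_iff₀ hS]
    exact hvS.trans (hgA σ hσ)

/-- A compact family of convex lower semicontinuous functions on a compact convex set of finite
dimension has a finite subfamily with the same minimal maximum, by Helly's theorem. -/
theorem exists_finite_subfamily {X W : Type*} [TopologicalSpace X] [CompactSpace X] [Nonempty X]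
    [AddCommGroup W] [Module ℝ W] [TopologicalSpace W] [T2Space W] [FiniteDimensional ℝ W]
    {K I : Set W} (hK : IsCompact K) (hIK : I ⊆ K) {f : X → W → ℝ≥0∞}
    (hconv : ∀ x c, Convex ℝ {σ ∈ K | f x σ ≤ c})
    (hlsc : ∀ x, LowerSemicontinuousOn (f x) K)
    (hcont : ∀ σ ∈ I, Continuous fun x => f x σ) {V : ℝ≥0∞} (hV : ∀ σ ∈ K, V ≤ ⨆ x, f x σ) :
    ∃ (m : ℕ) (y : Fin m → X), ∀ σ ∈ I, ∃ i, V ≤ f (y i) σ := by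
  classical
  have x₀ : X := Classical.arbitrary X
  -- If no finrank + 1 points suffice, any finrank + 1 of the compact convex sublevel sets at c
  -- meet. By Helly all of them meet, at a σ whose supremum is at most c < V.
  have helly : ∀ c < V, ∃ y : Fin (Module.finrank ℝ W + 1) → X, ∀ σ ∈ K, ∃ i, c < f (y i) σ := by
    intro c hc
    by_contra hcon
    push Not at hcon
    have hcomp : ∀ x, IsCompact {σ ∈ K | f x σ ≤ c} := fun x => by
      obtain ⟨v, hv, hvK⟩ := lowerSemicontinuousOn_iff_preimage_Iic.1 (hlsc x) c
      have : {σ ∈ K | f x σ ≤ c} = K ∩ v := hvK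
      rw [this]
      exact hK.inter_right hv
    obtain ⟨σ, hσ⟩ := Convex.helly_theorem_compact' (fun x => hconv x c) hcomp fun J hJ => by
      -- A smaller subfamily is padded with `x₀` to the fixed length.
      obtain ⟨e⟩ : Nonempty (J ↪ Fin (Module.finrank ℝ W + 1)) :=
        Function.Embedding.nonempty_of_card_le (by simpa using hJ)
      obtain ⟨σ, hσK, hσ⟩ := hcon (Function.extend e Subtype.val fun _ => x₀)
      refine ⟨σ, Set.mem_iInter₂.2 fun x hx => ⟨hσK, ?_⟩⟩
      have := hσ (e ⟨x, hx⟩)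
      rwa [e.injective.extend_apply] at this
    rw [Set.mem_iInter] at hσ
    exact absurd (hc.trans_le (hV σ (hσ x₀).1)) (not_lt.2 (iSup_le fun x => (hσ x).2))
  refine ⟨Module.finrank ℝ W + 1, ?_⟩
  rcases eq_or_ne V 0 with rfl | hV0
  · exact ⟨fun _ => x₀, fun σ _ => ⟨0, zero_le⟩⟩
  -- The points found depend on c. The sets of admissible tuples are closed, by continuity in x for
  -- σ in I, and shrink as c increases to V, so compactness yields one tuple valid for every c < V.
  let C : Set.Iio V → Set (Fin (Module.finrank ℝ W + 1) → X) := fun c =>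
    {y | ∀ σ ∈ I, ∃ i, c.1 ≤ f (y i) σ}
  have hCc : ∀ c, IsClosed (C c) := fun c => by
    have : C c = ⋂ σ ∈ I, ⋃ i, {y | c.1 ≤ f (y i) σ} := by
      ext y; simp [C]
    rw [this]
    refine isClosed_biInter fun σ hσ => isClosed_iUnion_of_finite fun i => ?_
    exact isClosed_le continuous_const ((hcont σ hσ).comp (continuous_apply i))
  have : Nonempty (Set.Iio V) := ⟨⟨0, pos_iff_ne_zero.2 hV0⟩⟩
  obtain ⟨y, hy⟩ := IsCompact.nonempty_iInter_of_directed_nonempty_isCompact_isClosed C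
    (fun c c' => ⟨⟨max c.1 c'.1, Set.mem_Iio.2 (max_lt c.2 c'.2)⟩,
      fun y hy σ hσ => (hy σ hσ).imp fun i hi => (le_max_left _ _).trans hi,
      fun y hy σ hσ => (hy σ hσ).imp fun i hi => (le_max_right _ _).trans hi⟩)
    (fun c => (helly c.1 c.2).imp fun y hy σ hσ => (hy σ (hIK hσ)).imp fun i hi => hi.le)
    (fun c => (hCc c).isCompact) hCc
  rw [Set.mem_iInter] at hy
  refine ⟨y, fun σ hσ => ?_⟩
  -- An index maximising f (y i) σ serves all c at once, so the bound passes to V.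
  obtain ⟨i, hi⟩ := Finite.exists_max fun i => f (y i) σ
  refine ⟨i, not_lt.1 fun hlt => ?_⟩
  obtain ⟨c, hc₁, hc₂⟩ := exists_between hlt
  obtain ⟨j, hj⟩ := hy ⟨c, hc₂⟩ σ hσ
  exact absurd (hc₁.trans_le hj) (not_lt.2 (hi j))

/-- A minimax theorem with attained extrema: the set `K` plays the role of the states `σ`, the
subset `I` that of the states of full rank. -/
theorem exists_minimax {X W : Type*} [TopologicalSpace X] [CompactSpace X] [Nonempty X]
    [AddCommGroup W] [Module ℝ W] [TopologicalSpace W] [T2Space W] [FiniteDimensional ℝ W]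
    {K I : Set W} (hK : IsCompact K) (hKc : Convex ℝ K) (hIK : I ⊆ K) (hIc : Convex ℝ I)
    {τ : W} (hτ : τ ∈ I)
    (hI : ∀ σ ∈ K, ∀ a b : ℝ, 0 < a → 0 < b → a + b = 1 → a • σ + b • τ ∈ I)
    {f : X → W → ℝ≥0∞}
    (hconv : ∀ x, ∀ σ ∈ K, ∀ σ' ∈ K, ∀ a b : ℝ, 0 < a → 0 < b → a + b = 1 →
      f x (a • σ + b • σ') ≤ ENNReal.ofReal a * f x σ + ENNReal.ofReal b * f x σ')
    (hlsc : ∀ x, LowerSemicontinuousOn (f x) K)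
    (hfin : ∀ x, ∀ σ ∈ I, f x σ ≠ ∞)
    (hcont : ∀ σ ∈ I, Continuous fun x => f x σ) :
    ∃ σ₀ ∈ K, (∀ σ ∈ K, ⨆ x, f x σ₀ ≤ ⨆ x, f x σ) ∧
      ∃ (m : ℕ) (p : Fin m → ℝ) (y : Fin m → X), (∀ i, 0 ≤ p i) ∧ ∑ i, p i = 1 ∧
        ∀ σ ∈ K, ⨆ x, f x σ₀ ≤ ∑ i, ENNReal.ofReal (p i) * f (y i) σ := by
  obtain ⟨σ₀, hσ₀, hmin⟩ := LowerSemicontinuousOn.exists_isMinOn ⟨τ, hIK hτ⟩ hK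
    (lowerSemicontinuousOn_iSup hlsc)
  have hmin : ∀ σ ∈ K, ⨆ x, f x σ₀ ≤ ⨆ x, f x σ := fun σ hσ => hmin hσ
  refine ⟨σ₀, hσ₀, hmin, ?_⟩
  set V := ⨆ x, f x σ₀ with hVdef
  -- At τ every value is finite, and by continuity and compactness the supremum over x is one of
  -- these values.
  have hVfin : V ≠ ∞ := by
    obtain ⟨x, -, hx⟩ := isCompact_univ.exists_isMaxOn (Set.univ_nonempty (α := X))
      (hcont τ hτ).continuousOn
    refine ((hmin τ (hIK hτ)).trans (iSup_le fun x' => hx (Set.mem_univ x'))).trans_lt ?_ |>.ne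
    exact (hfin x τ hτ).lt_top
  obtain ⟨m, y, hy⟩ := exists_finite_subfamily hK hIK (f := f) (fun x c => by
    refine convex_iff_forall_pos.2 fun σ hσ σ' hσ' a b ha hb hab =>
      ⟨hKc hσ.1 hσ'.1 ha.le hb.le hab, ?_⟩
    refine (hconv x σ hσ.1 σ' hσ'.1 a b ha hb hab).trans ?_
    calc _ ≤ ENNReal.ofReal a * c + ENNReal.ofReal b * c :=
          add_le_add (mul_le_mul_right hσ.2 _) (mul_le_mul_right hσ'.2 _)
      _ = c := by
          rw [← add_mul, ← ENNReal.ofReal_add ha.le hb.le, hab, ENNReal.ofReal_one, one_mul])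
    hlsc hcont hmin
  have hg : ∀ i, ConvexOn ℝ I fun σ => (f (y i) σ).toReal := fun i => by
    refine convexOn_iff_forall_pos.2 ⟨hIc, fun σ hσ σ' hσ' a b ha hb hab => ?_⟩
    have h1 := ENNReal.mul_ne_top (ENNReal.ofReal_ne_top (r := a)) (hfin (y i) σ hσ)
    have h2 := ENNReal.mul_ne_top (ENNReal.ofReal_ne_top (r := b)) (hfin (y i) σ' hσ')
    have := ENNReal.toReal_mono (ENNReal.add_ne_top.2 ⟨h1, h2⟩)
      (hconv (y i) σ (hIK hσ) σ' (hIK hσ') a b ha hb hab)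
    rwa [ENNReal.toReal_add h1 h2, ENNReal.toReal_mul, ENNReal.toReal_mul,
      ENNReal.toReal_ofReal ha.le, ENNReal.toReal_ofReal hb.le] at this
  obtain ⟨p, hp0, hp1, hp⟩ := exists_weights_le_sum ⟨τ, hτ⟩ hg (v := V.toReal) fun σ hσ =>
    (hy σ hσ).imp fun i hi => ENNReal.toReal_mono (hfin (y i) σ hσ) hi
  refine ⟨m, p, y, hp0, hp1, ?_⟩
  have hpI : ∀ σ ∈ I, V ≤ ∑ i, ENNReal.ofReal (p i) * f (y i) σ := fun σ hσ => by
    rw [← ENNReal.ofReal_toReal hVfin]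
    refine (ENNReal.ofReal_le_ofReal (hp σ hσ)).trans (le_of_eq ?_)
    rw [ENNReal.ofReal_sum_of_nonneg fun i _ => mul_nonneg (hp0 i) ENNReal.toReal_nonneg]
    refine Finset.sum_congr rfl fun i _ => ?_
    rw [ENNReal.ofReal_mul (hp0 i), ENNReal.ofReal_toReal (hfin (y i) σ hσ)]
  intro σ hσ
  set S := ∑ i, ENNReal.ofReal (p i) * f (y i) σ
  set T := ∑ i, ENNReal.ofReal (p i) * f (y i) τ with hT
  have hTfin : T ≠ ∞ := ENNReal.sum_ne_top.2 fun i _ =>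
    ENNReal.mul_ne_top ENNReal.ofReal_ne_top (hfin (y i) τ hτ)
  -- To reach σ outside I, move slightly towards τ, where the bound is known, and use convexity. `S`
  -- may be ∞, but `T` must be finite for its term to vanish as t tends to 0.
  have hlim : Tendsto (fun t : ℝ => ENNReal.ofReal (1 - t) * S + ENNReal.ofReal t * T) (𝓝[>] 0)
      (𝓝 S) := by
    have h1 : Tendsto (fun t : ℝ => ENNReal.ofReal (1 - t)) (𝓝 0) (𝓝 1) := by
      have h : Continuous fun t : ℝ => ENNReal.ofReal (1 - t) :=
        ENNReal.continuous_ofReal.comp (by fun_prop)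
      simpa using h.tendsto 0
    have h2 : Tendsto (fun t : ℝ => ENNReal.ofReal t) (𝓝 0) (𝓝 0) := by
      simpa using ENNReal.continuous_ofReal.tendsto 0
    have := (ENNReal.Tendsto.mul_const (b := S) h1 (Or.inl one_ne_zero)).add
      (ENNReal.Tendsto.mul_const (b := T) h2 (Or.inr hTfin))
    rw [one_mul, zero_mul, add_zero] at this
    exact this.mono_left nhdsWithin_le_nhds
  refine ge_of_tendsto hlim ?_
  filter_upwards [Ioo_mem_nhdsGT one_pos] with t ht
  have ha : 0 < 1 - t := sub_pos.2 ht.2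
  refine (hpI _ (hI σ hσ (1 - t) t ha ht.1 (by ring))).trans ?_
  rw [Finset.mul_sum, Finset.mul_sum, ← Finset.sum_add_distrib]
  refine Finset.sum_le_sum fun i _ => ?_
  refine (mul_le_mul_right (hconv (y i) σ hσ τ (hIK hτ) _ _ ha ht.1 (by ring)) _).trans
    (le_of_eq ?_)
  ring

end

/-! ### Block-diagonal operators and classical-quantum states -/

section

variable {m n : Type*} [Fintype m] [DecidableEq m] [Fintype n] [DecidableEq n]

/-- The block diagonal operator `∑ₓ |x⟩⟨x| ⊗ A x`. -/
def directSum {m n R : Type*} [DecidableEq m] [Zero R] (A : m → Matrix n n R) :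
    Matrix (m × n) (m × n) R :=
  (blockDiagonal A).submatrix Prod.swap Prod.swap

theorem directSum_apply {m n : Type*} [DecidableEq m] (A : m → Matrix n n ℂ) (i j : m × n) :
    directSum A i j = if i.1 = j.1 then A i.1 i.2 j.2 else 0 := by
  simp [directSum, blockDiagonal_apply]

theorem directSum_mul {m n : Type*} [Fintype m] [DecidableEq m] [Fintype n]
    (A B : m → Matrix n n ℂ) :
    directSum A * directSum B = directSum fun x => A x * B x := by
  rw [directSum, directSum, directSum, blockDiagonal_mul]
  exact submatrix_mul_equiv _ _ _ (Equiv.prodComm m n) _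

theorem directSum_one {m n : Type*} [DecidableEq m] [DecidableEq n] :
    directSum (fun _ : m => (1 : Matrix n n ℂ)) = 1 := by
  have : (fun _ : m => (1 : Matrix n n ℂ)) = 1 := rfl
  rw [directSum, this, blockDiagonal_one]
  exact submatrix_one_equiv (Equiv.prodComm m n)

theorem star_directSum {m n : Type*} [DecidableEq m] (A : m → Matrix n n ℂ) :
    star (directSum A) = directSum fun x => star (A x) := by
  rw [directSum, directSum, star_eq_conjTranspose, conjTranspose_submatrix,
    blockDiagonal_conjTranspose]
  rfl

theorem trace_directSum {m n : Type*} [Fintype m] [DecidableEq m] [Fintype n]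
    (A : m → Matrix n n ℂ) : (directSum A).trace = ∑ x, (A x).trace := by
  simp [trace, Fintype.sum_prod_type, directSum_apply]

theorem directSum_mulVec {m n : Type*} [Fintype m] [DecidableEq m] [Fintype n]
    (A : m → Matrix n n ℂ) (v : m × n → ℂ) (x : m) (i : n) :
    (directSum A *ᵥ v) (x, i) = (A x *ᵥ fun j => v (x, j)) i := by
  simp [mulVec, dotProduct, Fintype.sum_prod_type, directSum_apply]

/-- The direct sum of unitary matrices. -/
def unitaryDirectSum (U : m → unitaryGroup n ℂ) : unitaryGroup (m × n) ℂ :=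
  ⟨directSum fun x => (U x : Matrix n n ℂ), by
    rw [mem_unitaryGroup_iff, star_directSum, directSum_mul]
    simp only [unitary_mul_star, directSum_one]⟩

/-- Diagonalising each block diagonalises the whole, which makes positivity and powers blockwise. -/
theorem directSum_conjDiagonal (U : m → unitaryGroup n ℂ) (d : m → n → ℝ) :
    directSum (fun x => conjDiagonal (U x) (d x)) =
      conjDiagonal (unitaryDirectSum U) fun i => d i.1 i.2 := by
  have h : diagonal (fun i : m × n => (d i.1 i.2 : ℂ)) =
      directSum fun x => diagonal fun i => (d x i : ℂ) := by
    ext ⟨x, i⟩ ⟨y, j⟩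
    by_cases hx : x = y
    · subst hx
      by_cases hi : i = j
      · subst hi; simp [directSum_apply]
      · simp [directSum_apply, hi]
    · simp [directSum_apply, hx]
  simp only [conjDiagonal, unitaryDirectSum, h, star_directSum, directSum_mul]

theorem exists_directSum_conjDiagonal {m : Type*} {A : m → Matrix n n ℂ}
    (hA : ∀ x, (A x).PosSemidef) :
    ∃ (U : m → unitaryGroup n ℂ) (d : m → n → ℝ), (∀ x i, 0 ≤ d x i) ∧
      A = fun x => conjDiagonal (U x) (d x) := by
  choose U d hd h using fun x => exists_conjDiagonal (hA x)
  exact ⟨U, d, hd, funext h⟩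

theorem directSum_posSemidef {A : m → Matrix n n ℂ} (hA : ∀ x, (A x).PosSemidef) :
    (directSum A).PosSemidef := by
  obtain ⟨U, d, hd, rfl⟩ := exists_directSum_conjDiagonal hA
  rw [directSum_conjDiagonal]
  exact conjDiagonal_posSemidef _ fun i => hd _ _

theorem directSum_rpow {A : m → Matrix n n ℂ} (hA : ∀ x, (A x).PosSemidef) (r : ℝ) :
    directSum A ^ r = directSum fun x => A x ^ r := by
  obtain ⟨U, d, hd, rfl⟩ := exists_directSum_conjDiagonal hA
  rw [directSum_conjDiagonal, conjDiagonal_rpow _ fun i => hd _ _]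
  simp only [conjDiagonal_rpow _ (hd _)]
  rw [directSum_conjDiagonal]

theorem smul_rpow {A : Matrix n n ℂ} (hA : A.PosSemidef) {c : ℝ} (hc : 0 ≤ c) (r : ℝ) :
    (c • A) ^ r = c ^ r • A ^ r := by
  obtain ⟨U, d, hd, rfl⟩ := exists_conjDiagonal hA
  rw [smul_conjDiagonal, conjDiagonal_rpow _ fun i => mul_nonneg hc (hd i),
    conjDiagonal_rpow _ hd, smul_conjDiagonal]
  congr 1
  ext i
  exact Real.mul_rpow hc (hd i)

theorem supp_directSum_le_iff {A B : m → Matrix n n ℂ} :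
    supp (directSum A) ≤ supp (directSum B) ↔ ∀ x, supp (A x) ≤ supp (B x) := by
  simp only [supp_le_supp_iff]
  constructor
  · intro h x v hv
    have h1 := h (fun i => if i.1 = x then v i.2 else 0) (by
      ext ⟨y, i⟩
      rw [directSum_mulVec]
      by_cases hy : y = x
      · subst hy
        simpa using congrFun hv i
      · simp only [hy, if_false]
        exact congrFun (mulVec_zero (B y)) i)
    ext i
    have h2 := congrFun h1 (x, i)
    rw [directSum_mulVec] at h2
    simpa using h2
  · intro h v hv
    ext ⟨x, i⟩
    rw [directSum_mulVec]
    refine congrFun (h x _ ?_) i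
    ext j
    rw [← directSum_mulVec]
    exact congrFun hv (x, j)

theorem sandwichedQ_directSum {α : ℝ} {A B : m → Matrix n n ℂ}
    (hA : ∀ x, (A x).PosSemidef) (hB : ∀ x, (B x).PosSemidef) :
    sandwichedQ α (directSum A) (directSum B) = ∑ x, sandwichedQ α (A x) (B x) := by
  by_cases h : ∀ x, supp (A x) ≤ supp (B x)
  · rw [sandwichedQ_of_supp_le (supp_directSum_le_iff.2 h), directSum_rpow hB, directSum_mul,
      directSum_mul, tracePow, directSum_rpow fun x => sandwiched_posSemidef (hA x) _ _,
      trace_directSum, Complex.re_sum]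
    refine (ENNReal.ofReal_sum_of_nonneg fun x _ => tracePow_nonneg α _).trans ?_
    exact Finset.sum_congr rfl fun x _ => (sandwichedQ_of_supp_le (h x)).symm
  · rw [sandwichedQ, if_neg (mt supp_directSum_le_iff.1 h)]
    push Not at h
    obtain ⟨x, hx⟩ := h
    exact (ENNReal.sum_eq_top.2 ⟨x, Finset.mem_univ x, if_neg hx⟩).symm

/-- With r = (1-α)/(2α), scaling multiplies the sandwich by c^(2r+1) = c^(1/α), and the outer power
α turns this into c. -/
theorem sandwichedQ_smul_smul {α : ℝ} (hα : 1 < α) {A B : Matrix n n ℂ} (hA : A.PosSemidef)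
    (hB : B.PosSemidef) {c : ℝ} (hc : 0 ≤ c) :
    sandwichedQ α (c • A) (c • B) = ENNReal.ofReal c * sandwichedQ α A B := by
  -- For c = 0 both sides vanish even if Q(A‖B) = ∞, by 0 · ∞ = 0; letters of probability zero thus
  -- cause no trouble.
  rcases hc.eq_or_lt with rfl | hc
  · rw [zero_smul, zero_smul, sandwichedQ_of_supp_le le_rfl, Matrix.mul_zero, Matrix.zero_mul,
      tracePow, zero_rpow_matrix (by linarith)]
    simp
  · have hs : supp (c • A) ≤ supp (c • B) ↔ supp A ≤ supp B := by
      simp [supp_le_supp_iff, smul_mulVec, hc.ne']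
    by_cases h : supp A ≤ supp B
    · rw [sandwichedQ_of_supp_le h, sandwichedQ_of_supp_le (hs.2 h), smul_rpow hB hc.le]
      set r := (1 - α) / (2 * α) with hr
      have h1 : c ^ r • B ^ r * c • A * c ^ r • B ^ r = c ^ (1 / α) • (B ^ r * A * B ^ r) := by
        simp only [Matrix.smul_mul, Matrix.mul_smul, smul_smul]
        congr 1
        nth_rewrite 2 [← Real.rpow_one c]
        rw [← Real.rpow_add hc, ← Real.rpow_add hc, hr]
        congr 1
        field_simp
        ring
      rw [h1, tracePow, smul_rpow (sandwiched_posSemidef hA B r) (Real.rpow_nonneg hc.le _),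
        ← Real.rpow_mul hc.le, one_div_mul_cancel (by linarith), Real.rpow_one, trace_smul,
        Complex.real_smul, Complex.re_ofReal_mul, ENNReal.ofReal_mul hc.le]
      rfl
    · rw [sandwichedQ, sandwichedQ, if_neg h, if_neg (mt hs.1 h), ENNReal.mul_top]
      simpa using hc

theorem Ensemble.cqState_eq {n : Type*} [Fintype n] (E : Ensemble n) :
    E.cqState = directSum fun x => E.prob x • (E.state x).toMatrix := by
  ext ⟨x, i⟩ ⟨y, j⟩
  rw [Ensemble.cqState, Matrix.sum_apply, directSum_apply]
  simp only [Matrix.smul_apply, kroneckerMap_apply, single_apply, smul_eq_mul, Complex.real_smul]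
  by_cases h : x = y
  · subst h
    rw [Finset.sum_eq_single x]
    · simp
    · intro z _ hz
      simp [hz]
    · simp
  · rw [if_neg h]
    refine Finset.sum_eq_zero fun z _ => ?_
    have : ¬ (z = x ∧ z = y) := fun hz => h (hz.1.symm.trans hz.2)
    simp [this]

theorem Ensemble.partialTraceRight_kronecker_eq {n : Type*} [Fintype n] (E : Ensemble n)
    (σ : Matrix n n ℂ) :
    partialTraceRight E.cqState ⊗ₖ σ = directSum fun x => E.prob x • σ := by
  have hX : partialTraceRight E.cqState = diagonal fun x => (E.prob x : ℂ) := by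
    ext x y
    simp only [partialTraceRight, of_apply, E.cqState_eq, directSum_apply]
    by_cases h : x = y
    · subst h
      have := (E.state x).trace_eq_one
      simp only [trace, diag_apply] at this
      simp [← Finset.mul_sum, this]
    · simp [h]
  rw [hX]
  ext ⟨x, i⟩ ⟨y, j⟩
  by_cases h : x = y
  · subst h; simp [directSum_apply, kroneckerMap_apply]
  · simp [directSum_apply, kroneckerMap_apply, h]

theorem Ensemble.sandwichedQ_cqState {α : ℝ} (hα : 1 < α) (E : Ensemble n) {σ : Matrix n n ℂ}
    (hσ : σ.PosSemidef) :
    sandwichedQ α E.cqState (partialTraceRight E.cqState ⊗ₖ σ) =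
      ∑ x, ENNReal.ofReal (E.prob x) * sandwichedQ α (E.state x).toMatrix σ := by
  rw [E.partialTraceRight_kronecker_eq, E.cqState_eq,
    sandwichedQ_directSum (fun x => (E.state x).posSemidef.smul (E.prob_nonneg x))
      (fun x => hσ.smul (E.prob_nonneg x))]
  exact Finset.sum_congr rfl fun x _ =>
    sandwichedQ_smul_smul hα (E.state x).posSemidef hσ (E.prob_nonneg x)

/-- Carries inequalities, and with them minimisers and maximisers, from Q to D. -/
theorem monotone_renyi {α : ℝ} (hα : 1 < α) :
    Monotone fun q : ℝ≥0∞ => ((1 / (α - 1) : ℝ) : EReal) * log₂ q := by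
  intro q q' h
  refine mul_le_mul_of_nonneg_left ?_ (EReal.coe_nonneg.2 (one_div_nonneg.2 (by linarith)))
  exact EReal.div_le_div_right_of_nonneg (EReal.coe_nonneg.2 (Real.log_nonneg one_le_two))
    (ENNReal.log_monotone h)

/-! ### Compactness and convexity of the set of states -/

/-- The set of density matrices. -/
def densitySet (n : Type*) [Fintype n] : Set (Matrix n n ℂ) :=
  {ρ | ρ.PosSemidef ∧ ρ.trace = 1}

theorem DensityOperator.mem_densitySet {n : Type*} [Fintype n] (ρ : DensityOperator n) :
    ρ.toMatrix ∈ densitySet n :=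
  ⟨ρ.posSemidef, ρ.trace_eq_one⟩

theorem isClosed_densitySet {n : Type*} [Fintype n] : IsClosed (densitySet n) := by
  have h : densitySet n = {ρ | ρᴴ = ρ} ∩
      (⋂ v : n → ℂ, {ρ | 0 ≤ star v ⬝ᵥ (ρ *ᵥ v)}) ∩ {ρ | ρ.trace = 1} := by
    ext ρ
    simp [densitySet, posSemidef_iff_dotProduct_mulVec, IsHermitian]
  rw [h]
  refine ((isClosed_eq continuous_id.matrix_conjTranspose continuous_id).inter ?_).inter
    (isClosed_eq continuous_id.matrix_trace continuous_const)
  refine isClosed_iInter fun v => isClosed_le continuous_const ?_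
  exact continuous_const.dotProduct (continuous_id.matrix_mulVec continuous_const)

theorem norm_apply_le_one {ρ : Matrix n n ℂ} (hρ : ρ ∈ densitySet n) (i j : n) :
    ‖ρ i j‖ ≤ 1 := by
  obtain ⟨hρ, ht⟩ := hρ
  obtain ⟨U, d, hd, rfl⟩ := exists_conjDiagonal hρ
  rw [trace_conjDiagonal] at ht
  have ht : ∑ k, d k = 1 := by exact_mod_cast ht
  rw [conjDiagonal, Matrix.mul_apply, ← ht]
  refine (norm_sum_le _ _).trans (Finset.sum_le_sum fun k _ => ?_)
  rw [mul_diagonal, star_apply, norm_mul, norm_mul, norm_star, Complex.norm_real,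
    Real.norm_of_nonneg (hd k)]
  have h1 := entry_norm_bound_of_unitary U.2 i k
  have h2 := entry_norm_bound_of_unitary U.2 j k
  calc _ ≤ 1 * d k * 1 := by
        refine mul_le_mul (mul_le_mul_of_nonneg_right h1 (hd k)) h2 (norm_nonneg _) ?_
        simpa using hd k
    _ = d k := by ring

theorem isCompact_densitySet {n : Type*} [Fintype n] : IsCompact (densitySet n) := by
  classical
  have h : IsCompact (Set.univ.pi fun _ : n =>
      Set.univ.pi fun _ : n => Metric.closedBall (0 : ℂ) 1) :=
    isCompact_univ_pi fun _ => isCompact_univ_pi fun _ => isCompact_closedBall 0 1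
  refine h.of_isClosed_subset isClosed_densitySet fun ρ hρ i _ j _ => ?_
  simpa using norm_apply_le_one hρ i j

theorem convex_densitySet {n : Type*} [Fintype n] : Convex ℝ (densitySet n) := by
  rintro ρ ⟨hρ, hρt⟩ σ ⟨hσ, hσt⟩ a b ha hb hab
  refine ⟨(hρ.smul ha).add (hσ.smul hb), ?_⟩
  rw [trace_add, trace_smul, trace_smul, hρt, hσt, ← add_smul, hab, one_smul]

end

/-! ### Extrema and minimax for channel outputs -/

section

variable {a b : Type*} [Fintype a] [Fintype b] [DecidableEq b]

theorem QuantumChannel.continuous {a b : Type*} [Fintype a] [Fintype b]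
    (N : QuantumChannel a b) : Continuous N.toLinearMap :=
  N.toLinearMap.continuous_of_finiteDimensional

theorem QuantumChannel.apply_mem_densitySet {a b : Type*} [Fintype a] [Fintype b]
    (N : QuantumChannel a b) {ρ : Matrix a a ℂ}
    (hρ : ρ ∈ densitySet a) : N.toLinearMap ρ ∈ densitySet b :=
  ⟨N.completelyPositive.posSemidef hρ.1, (N.tracePreserving ρ).trans hρ.2⟩

theorem exists_posDef_mem_densitySet (n : Type*) [Fintype n] [Nonempty n] :
    ∃ τ ∈ densitySet n, τ.PosDef := by
  classical
  have hc : (0 : ℝ) < Fintype.card n := Nat.cast_pos.2 Fintype.card_pos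
  refine ⟨((Fintype.card n : ℝ)⁻¹) • 1, ⟨PosSemidef.one.smul (inv_nonneg.2 hc.le), ?_⟩,
    PosDef.one.smul (inv_pos.2 hc)⟩
  rw [trace_smul, trace_one, Complex.real_smul]
  push_cast
  exact inv_mul_cancel₀ (by exact_mod_cast hc.ne')

/-- On an empty index type every trace is 0, yet an output state has trace 1. -/
theorem QuantumChannel.nonempty_output {a b : Type*} [Fintype a] [Fintype b] [Nonempty a]
    (N : QuantumChannel a b) : Nonempty b := by
  obtain ⟨ρ, hρ⟩ := exists_posDef_mem_densitySet a
  by_contra h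
  rw [not_nonempty_iff] at h
  have := (N.apply_mem_densitySet hρ.1).2
  simp [trace] at this

/-- Either every output is supported in σ and Q is continuous on a compact set, or some output
leaves the support and attains ∞. -/
theorem QuantumChannel.exists_max_sandwichedQ [Nonempty a] (N : QuantumChannel a b) {α : ℝ}
    (hα : 1 < α) (σ : DensityOperator b) :
    ∃ ρ : DensityOperator a, ∀ ρ' : DensityOperator a,
      sandwichedQ α (N.apply ρ').toMatrix σ.toMatrix ≤
        sandwichedQ α (N.apply ρ).toMatrix σ.toMatrix := by
  by_cases h : ∀ ρ ∈ densitySet a, supp (N.toLinearMap ρ) ≤ supp σ.toMatrix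
  · have hc : ContinuousOn (fun ρ => sandwichedQ α (N.toLinearMap ρ) σ.toMatrix) (densitySet a) :=
      (continuousOn_sandwichedQ_left hα σ.toMatrix).comp N.continuous.continuousOn
        fun ρ hρ => ⟨(N.apply_mem_densitySet hρ).1, h ρ hρ⟩
    obtain ⟨τ, hτ, -⟩ := exists_posDef_mem_densitySet a
    obtain ⟨ρ, hρ, hmax⟩ := isCompact_densitySet.exists_isMaxOn ⟨τ, hτ⟩ hc
    exact ⟨⟨ρ, hρ.1, hρ.2⟩, fun ρ' => hmax ρ'.mem_densitySet⟩
  · push Not at h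
    obtain ⟨ρ, hρ, hs⟩ := h
    refine ⟨⟨ρ, hρ.1, hρ.2⟩, fun ρ' => le_top.trans (le_of_eq ?_)⟩
    exact (if_neg hs).symm

/-- Q is lower semicontinuous on the compact image of the states under σ ↦ ρ_X ⊗ σ. -/
theorem Ensemble.exists_min_sandwichedQ [Nonempty b] {α : ℝ} (hα : 1 < α) (E : Ensemble b) :
    ∃ σ : DensityOperator b, ∀ σ' : DensityOperator b,
      sandwichedQ α E.cqState (partialTraceRight E.cqState ⊗ₖ σ.toMatrix) ≤
        sandwichedQ α E.cqState (partialTraceRight E.cqState ⊗ₖ σ'.toMatrix) := by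
  obtain ⟨τ, hτ, -⟩ := exists_posDef_mem_densitySet b
  have hcq : E.cqState.PosSemidef := by
    rw [E.cqState_eq]
    exact directSum_posSemidef fun x => (E.state x).posSemidef.smul (E.prob_nonneg x)
  have hcont : Continuous fun σ : Matrix b b ℂ => partialTraceRight E.cqState ⊗ₖ σ :=
    continuous_matrix fun i j => continuous_const.mul (continuous_id.matrix_elem i.2 j.2)
  have hsub : (fun σ => partialTraceRight E.cqState ⊗ₖ σ) '' densitySet b ⊆
      {B | B.PosSemidef} := by
    rintro _ ⟨σ, hσ, rfl⟩
    simp only [E.partialTraceRight_kronecker_eq]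
    exact directSum_posSemidef fun x => hσ.1.smul (E.prob_nonneg x)
  obtain ⟨_, ⟨σ, hσ, rfl⟩, hmin⟩ := LowerSemicontinuousOn.exists_isMinOn
    (Set.Nonempty.image _ ⟨τ, hτ⟩) (isCompact_densitySet.image hcont)
    ((lowerSemicontinuousOn_sandwichedQ hα hcq).mono hsub)
  exact ⟨⟨σ, hσ.1, hσ.2⟩, fun σ' => hmin ⟨_, σ'.mem_densitySet, rfl⟩⟩

/-- The minimax theorem for the quasi-relative entropy of the outputs of a channel. -/
theorem QuantumChannel.exists_minimax_sandwichedQ [Nonempty a] (N : QuantumChannel a b) {α : ℝ}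
    (hα : 1 < α) :
    ∃ (σ₀ : DensityOperator b) (ρ₀ : DensityOperator a) (E₀ : Ensemble a),
      (∀ ρ, sandwichedQ α (N.apply ρ).toMatrix σ₀.toMatrix ≤
        sandwichedQ α (N.apply ρ₀).toMatrix σ₀.toMatrix) ∧
      (∀ σ : DensityOperator b, ∃ ρ, sandwichedQ α (N.apply ρ₀).toMatrix σ₀.toMatrix ≤
        sandwichedQ α (N.apply ρ).toMatrix σ.toMatrix) ∧
      ∀ σ : DensityOperator b, sandwichedQ α (N.apply ρ₀).toMatrix σ₀.toMatrix ≤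
        ∑ x, ENNReal.ofReal (E₀.prob x) *
          sandwichedQ α (N.apply (E₀.state x)).toMatrix σ.toMatrix := by
  have := N.nonempty_output
  obtain ⟨τ, hτ, hτ'⟩ := exists_posDef_mem_densitySet b
  obtain ⟨τa, hτa, -⟩ := exists_posDef_mem_densitySet a
  have : CompactSpace (densitySet a) := isCompact_iff_compactSpace.1 isCompact_densitySet
  have : Nonempty (densitySet a) := ⟨⟨τa, hτa⟩⟩
  have hN : ∀ ρ : densitySet a, (N.toLinearMap ρ).PosSemidef := fun ρ =>
    (N.apply_mem_densitySet ρ.2).1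
  obtain ⟨σ₀, hσ₀, hmin, m, p, y, hp0, hp1, hp⟩ := exists_minimax (X := densitySet a)
    (K := densitySet b) (I := densitySet b ∩ {σ | σ.PosDef})
    (f := fun ρ σ => sandwichedQ α (N.toLinearMap ρ) σ)
    isCompact_densitySet convex_densitySet Set.inter_subset_left
    (convex_densitySet.inter (convex_iff_forall_pos.2 fun σ hσ σ' hσ' s t hs ht _ =>
      PosDef.add (PosDef.smul hσ hs) (PosDef.smul hσ' ht)))
    ⟨hτ, hτ'⟩
    (fun σ hσ s t hs ht hst => ⟨convex_densitySet hσ hτ hs.le ht.le hst,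
      PosDef.posSemidef_add (hσ.1.smul hs.le) (hτ'.smul ht)⟩)
    (fun ρ σ hσ σ' hσ' s t hs ht hst => sandwichedQ_convex hα (hN ρ) hσ.1 hσ'.1 hs ht hst)
    (fun ρ => (lowerSemicontinuousOn_sandwichedQ hα (hN ρ)).mono fun σ hσ => hσ.1)
    (fun ρ σ hσ => by
      rw [sandwichedQ_of_supp_le (supp_le_supp_of_posDef _ hσ.2)]
      exact ENNReal.ofReal_ne_top)
    (fun σ hσ => (continuousOn_sandwichedQ_left hα σ).comp_continuous
      (N.continuous.comp continuous_subtype_val)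
      fun ρ => ⟨hN ρ, supp_le_supp_of_posDef _ hσ.2⟩)
  obtain ⟨ρ₀, hρ₀⟩ := N.exists_max_sandwichedQ hα ⟨σ₀, hσ₀.1, hσ₀.2⟩
  have hle : sandwichedQ α (N.apply ρ₀).toMatrix σ₀ ≤
      ⨆ ρ : densitySet a, sandwichedQ α (N.toLinearMap ρ) σ₀ :=
    le_iSup (fun ρ : densitySet a => sandwichedQ α (N.toLinearMap ρ) σ₀)
      ⟨ρ₀.toMatrix, ρ₀.mem_densitySet⟩
  -- The minimax weights and points are read as the probabilities and states of the optimal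
  -- ensemble.
  refine ⟨⟨σ₀, hσ₀.1, hσ₀.2⟩, ρ₀, ⟨m, p, hp0, hp1, fun x => ⟨y x, (y x).2.1, (y x).2.2⟩⟩, hρ₀,
    fun σ => ?_, fun σ => hle.trans (hp σ.toMatrix σ.mem_densitySet)⟩
  obtain ⟨ρ, hρ⟩ := N.exists_max_sandwichedQ hα σ
  refine ⟨ρ, (hle.trans (hmin σ.toMatrix σ.mem_densitySet)).trans (iSup_le fun ρ' => ?_)⟩
  exact hρ ⟨ρ', ρ'.2.1, ρ'.2.2⟩

theorem Ensemble.ensembleDivergence_map {α : ℝ} (hα : 1 < α) (E : Ensemble a)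
    (N : QuantumChannel a b) (σ : DensityOperator b) :
    ensembleDivergence α (E.map N) σ = ((1 / (α - 1) : ℝ) : EReal) *
      log₂ (∑ x, ENNReal.ofReal (E.prob x) *
        sandwichedQ α (N.apply (E.state x)).toMatrix σ.toMatrix) := by
  rw [ensembleDivergence, sandwichedD, (E.map N).sandwichedQ_cqState hα σ.posSemidef]
  rfl

end

end SandwichedRenyi

end

/-! ### Holevo information and radius -/

theorem mainTheorem5 {a b : Type*} [Fintype a] [Nonempty a] [Fintype b] [DecidableEq b]
    (N : SandwichedRenyi.QuantumChannel a b) (α : ℝ) (hα₁ : 1 < α) (hα₂ : α ≤ 2) :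
    SandwichedRenyi.alphaHolevo α N = SandwichedRenyi.alphaRadius α N ∧
    (∀ E : SandwichedRenyi.Ensemble a, ∃ σ : SandwichedRenyi.DensityOperator b,
      SandwichedRenyi.ensembleDivergence α (E.map N) σ =
        SandwichedRenyi.ensembleHolevo α (E.map N)) ∧
    (∃ E : SandwichedRenyi.Ensemble a,
      SandwichedRenyi.ensembleHolevo α (E.map N) = SandwichedRenyi.alphaHolevo α N) ∧
    (∀ σ : SandwichedRenyi.DensityOperator b, ∃ ρ : SandwichedRenyi.DensityOperator a,
      SandwichedRenyi.sandwichedD α (N.apply ρ).toMatrix σ.toMatrix =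
        SandwichedRenyi.maxOutputDivergence α N σ) ∧
    (∃ σ : SandwichedRenyi.DensityOperator b,
      SandwichedRenyi.maxOutputDivergence α N σ = SandwichedRenyi.alphaRadius α N) := by
  have := N.nonempty_output
  have hmono := SandwichedRenyi.monotone_renyi hα₁
  obtain ⟨σ₀, ρ₀, E₀, hρ₀, hσ₀, hE₀⟩ := N.exists_minimax_sandwichedQ hα₁
  set V := SandwichedRenyi.sandwichedD α (N.apply ρ₀).toMatrix σ₀.toMatrix with hV
  have hmax : SandwichedRenyi.maxOutputDivergence α N σ₀ = V :=
    le_antisymm (iSup_le fun ρ => hmono (hρ₀ ρ))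
      (le_iSup (fun ρ => SandwichedRenyi.sandwichedD α (N.apply ρ).toMatrix σ₀.toMatrix) ρ₀)
  have hradius : SandwichedRenyi.alphaRadius α N = V := by
    refine le_antisymm ((iInf_le _ σ₀).trans hmax.le) (le_iInf fun σ => ?_)
    obtain ⟨ρ, hρ⟩ := hσ₀ σ
    exact (hmono hρ).trans
      (le_iSup (fun ρ => SandwichedRenyi.sandwichedD α (N.apply ρ).toMatrix σ.toMatrix) ρ)
  -- Testing with σ₀, an average of Q over the ensemble is at most the maximum over inputs.
  have hupper : ∀ E : SandwichedRenyi.Ensemble a,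
      SandwichedRenyi.ensembleHolevo α (E.map N) ≤ V := fun E => by
    refine (iInf_le _ σ₀).trans ?_
    rw [E.ensembleDivergence_map hα₁]
    refine hmono ((Finset.sum_le_sum fun x _ => mul_le_mul_right (hρ₀ (E.state x)) _).trans ?_)
    rw [← Finset.sum_mul, ← ENNReal.ofReal_sum_of_nonneg fun x _ => E.prob_nonneg x, E.sum_prob,
      ENNReal.ofReal_one, one_mul]
  -- For `E₀` the averaged Q is at least the minimax value for every σ.
  have hlower : V ≤ SandwichedRenyi.ensembleHolevo α (E₀.map N) := le_iInf fun σ => by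
    rw [E₀.ensembleDivergence_map hα₁]
    exact hmono (hE₀ σ)
  have hholevo : SandwichedRenyi.alphaHolevo α N = V :=
    le_antisymm (iSup_le hupper) (hlower.trans
      (le_iSup (fun E : SandwichedRenyi.Ensemble a =>
        SandwichedRenyi.ensembleHolevo α (E.map N)) E₀))
  refine ⟨hholevo.trans hradius.symm, fun E => ?_,
    ⟨E₀, (le_antisymm (hupper E₀) hlower).trans hholevo.symm⟩, fun σ => ?_,
    ⟨σ₀, hmax.trans hradius.symm⟩⟩
  · obtain ⟨σ, hσ⟩ := (E.map N).exists_min_sandwichedQ hα₁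
    exact ⟨σ, le_antisymm (le_iInf fun σ' => hmono (hσ σ')) (iInf_le _ σ)⟩
  · obtain ⟨ρ, hρ⟩ := N.exists_max_sandwichedQ hα₁ σ
    exact ⟨ρ, le_antisymm
      (le_iSup (fun ρ => SandwichedRenyi.sandwichedD α (N.apply ρ).toMatrix σ.toMatrix) ρ)
      (iSup_le fun ρ' => hmono (hρ ρ'))⟩
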